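/- Let $\mathbb K^3=\mathbb R^3$ be the projective (Kleinian) model of the three-dimensional extended hyperbolic space, in which $\mathbb H^3$ is the open unit ball and $\partial\mathbb H^3$ is the unit sphere. For $\varepsilon>0$ put $d_\varepsilon=1-\varepsilon i$ and $$dV_\varepsilon=\frac{d_\varepsilon\,dx_1\,dx_2\,dx_3}{(d_\varepsilon^2-|x|^2)^2}.$$ Let $0<\alpha\le 1$ and let $U\subset\mathbb R^3$ be a Lebesgue measurable set (for instance a domain) that is $C^{1,\alpha}$-transversal to $\partial\mathbb H^3$, that is: every point $p\in\partial U\cap\partial\mathbb H^3$ has an open neighbourhood $V$ and a $C^{1,\alpha}$ function $f:V\to\mathbb R$ (continuously differentiable, with $\alpha$-Hölder continuous derivative) such that $\partial U\cap V=\{x\in V: f(x)=0\}$ and such that, at every point of $\{f=0\}\cap\partial\mathbb H^3$, the differential of $f$ is nonzero and its kernel together with the tangent plane of the sphere $\partial\mathbb H^3$ spans $\mathbb R^3$. Then $U$ has finite volume: the integrals $\int_U dV_\varepsilon$ converge absolutely for every $\varepsilon>0$, and the limit $$\mu(U)=\lim_{\varepsilon\to0^+}\int_U dV_\varepsilon$$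 exists in $\mathbb C$. -/

import Mathlib

open MeasureTheory Filter Topology
open scoped NNReal

/-- The projective (Kleinian) model `𝕂³` of the three-dimensional extended hyperbolic space:
the affine space `ℝ³` with its Euclidean norm. The open unit ball is `ℍ³`, the exterior of the
closed unit ball is the Lorentz part `𝕃³`. -/
abbrev K3 : Type := EuclideanSpace ℝ (Fin 3)

/-- The common boundary `∂ℍ³` of the hyperbolic and the Lorentz part: the unit sphere of `𝕂³`. -/
def boundaryH3 : Set K3 := Metric.sphere 0 1

/-- The complex number `d_ε = 1 - ε i`. -/
noncomputable def dEps (ε : ℝ) : ℂ := 1 - (ε : ℂ) * Complex.I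

/-- The density of the volume form `dV_ε = d_ε dx₁ dx₂ dx₃ / (d_ε² - |x|²)²` with respect to
Lebesgue measure. (The exponent `(n + 1) / 2` is `2` for `n = 3`, so no branch of a power has to be
chosen.) -/
noncomputable def volDensity (ε : ℝ) (x : K3) : ℂ :=
  dEps ε / ((dEps ε) ^ 2 - ((‖x‖ : ℝ) : ℂ) ^ 2) ^ 2

/-- `m` is the value of `μ(U) = lim_{ε → 0+} ∫_U dV_ε`: for every `ε > 0` the integral
converges absolutely, and the integrals tend to the (finite) complex number `m`. -/
def HasMu (U : Set K3) (m : ℂ) : Prop :=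
  (∀ ε : ℝ, 0 < ε → IntegrableOn (volDensity ε) U volume) ∧
    Tendsto (fun ε : ℝ => ∫ x in U, volDensity ε x) (𝓝[>] 0) (𝓝 m)

/-- `f` is a `C^{1,α}` function on the open set `V`: it is continuously differentiable there, with
`α`-Hölder continuous derivative. -/
def IsC1Holder (α : ℝ≥0) (f : K3 → ℝ) (V : Set K3) : Prop :=
  ContDiffOn ℝ 1 f V ∧ ∃ C : ℝ≥0, HolderOnWith C α (fderiv ℝ f) V

/-- The zero set of `f` is, at its point `q ∈ ∂ℍ³`, a regular surface transversal to `∂ℍ³`: the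
differential of `f` at `q` does not vanish, and its kernel (the tangent plane of the zero set)
together with `q^⊥` (the tangent plane of `∂ℍ³` at `q`) spans `ℝ³`. -/
def IsTransversalAt (f : K3 → ℝ) (q : K3) : Prop :=
  fderiv ℝ f q ≠ 0 ∧ (fderiv ℝ f q).toLinearMap.ker ⊔ (Submodule.span ℝ {q})ᗮ = ⊤

/-- `U` is `C^{1,α}`-transversal to `∂ℍ³`: near each point `p` of `∂ℍ³` on the boundary of `U`, the
boundary of `U` is the zero set of a single `C^{1,α}` function transversal to `∂ℍ³`. -/
def IsC1HolderTransversal (α : ℝ≥0) (U : Set K3) : Prop :=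
  ∀ p ∈ frontier U ∩ boundaryH3, ∃ V : Set K3, IsOpen V ∧ p ∈ V ∧
    ∃ f : K3 → ℝ, IsC1Holder α f V ∧ frontier U ∩ V = {x ∈ V | f x = 0} ∧
      ∀ q ∈ V ∩ boundaryH3, f q = 0 → IsTransversalAt f q

/-!
The density of `dV_ε` depends on `|x|` only and degenerates to `1 / (1 - |x|²)²` as `ε → 0`, which
has a second-order singularity along the unit sphere. Away from the sphere the limit exists by
dominated convergence (`exists_tendsto_setIntegral_diff_shell`). In a thin shell around the sphere
the integral is, in polar coordinates, that of `r² A(r) d_ε / (d_ε² - r²)²`, where `A(r)` is the area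
of the spherical slice `{θ | r θ ∈ U}` (`setIntegral_inter_shell`). If
`A(r) = a + b (r - 1) + O(|r - 1|^(1 + α))`, then `r² A(r)` is a combination of `r` and
`r (r² - 1)`, whose integrals are explicit and converge, up to an error `O(|r - 1|^(1 + α))`, which
leaves an integrable singularity `|r - 1|^(α - 1)` (`ExpandsAtOne.exists_tendsto`). Thus everything
reduces to such an expansion of `A` (`expandsAtOne_slice`).

The expansion is local on the sphere, by a partition of unity. Near a point `p` of the sphere on the
frontier of `U`, transversality provides a unit vector `e` orthogonal to `p` along which the defining
function `f` of the frontier increases. The surface measure is invariant under the rotations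
`planeRot p e τ` in the plane of `p` and `e`, so the weighted area of the slice is the mean over `θ`
of integrals along the orbits `τ ↦ planeRot p e τ θ` (`integral_sphere_eq_average`). Along such an
orbit, scaled by `r`, `f` is strictly increasing, so membership in `U` changes at most once, at an
angle `h(r)` with `f (r • planeRot p e (h r) θ) = 0`. As `f` is `C^{1,α}`, the angle has an expansion
`h(1) + D (r - 1) + O(|r - 1|^(1 + α))` uniform in `θ` (`exists_zero_expansion`, `exists_crossing`),
which is inherited by the orbit integrals (`step_integral_expansion`) and, after integration over
`θ`, by `A` (`expandsAtOne_integral`). This averaging over rotations replaces local coordinates.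
The same average shows that the slices of the frontier are null sets near the sphere, so that `U` may
be replaced there by its interior.
-/

/-! ### Rotations in a plane -/

section Rotation

open scoped RealInnerProductSpace

variable {E : Type*} [NormedAddCommGroup E] [InnerProductSpace ℝ E]

/-- The infinitesimal generator of the rotations in the plane spanned by an orthonormal pair
`p, e`, turning `p` towards `e`. -/
noncomputable def rotGen (p e : E) : E →L[ℝ] E :=
  (innerSL ℝ p).smulRight e - (innerSL ℝ e).smulRight p

/-- The rotation by the angle `τ` in the plane spanned by an orthonormal pair `p, e`; it fixes the
orthogonal complement of that plane. -/
noncomputable def planeRot (p e : E) (τ : ℝ) : E →L[ℝ] E :=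
  ContinuousLinearMap.id ℝ E +
    ((innerSL ℝ p).smulRight ((Real.cos τ - 1) • p + Real.sin τ • e) +
      (innerSL ℝ e).smulRight ((Real.cos τ - 1) • e - Real.sin τ • p))

lemma rotGen_apply (p e x : E) : rotGen p e x = ⟪p, x⟫ • e - ⟪e, x⟫ • p := by
  simp [rotGen]

lemma planeRot_apply (p e x : E) (τ : ℝ) :
    planeRot p e τ x = x + (⟪p, x⟫ • ((Real.cos τ - 1) • p + Real.sin τ • e) +
      ⟪e, x⟫ • ((Real.cos τ - 1) • e - Real.sin τ • p)) := by
  simp [planeRot]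

lemma planeRot_zero (p e x : E) : planeRot p e 0 x = x := by
  simp [planeRot_apply]

lemma continuous_planeRot (p e : E) : Continuous fun z : ℝ × E => planeRot p e z.1 z.2 := by
  simp only [planeRot_apply]
  fun_prop

variable {p e : E}

lemma norm_rotGen_le (hp : ‖p‖ = 1) (he : ‖e‖ = 1) (x : E) : ‖rotGen p e x‖ ≤ 2 * ‖x‖ := by
  rw [rotGen_apply]
  refine (norm_sub_le _ _).trans ?_
  rw [norm_smul, norm_smul, hp, he]
  have h1 := norm_inner_le_norm (𝕜 := ℝ) p x
  have h2 := norm_inner_le_norm (𝕜 := ℝ) e x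
  rw [hp] at h1
  rw [he] at h2
  linarith

lemma hasDerivAt_planeRot (hp : ‖p‖ = 1) (he : ‖e‖ = 1) (hpe : ⟪p, e⟫ = 0) (x : E) (τ : ℝ) :
    HasDerivAt (fun t => planeRot p e t x) (rotGen p e (planeRot p e τ x)) τ := by
  have hpp : ⟪p, p⟫ = 1 := by simp [hp]
  have hee : ⟪e, e⟫ = 1 := by simp [he]
  have hep : ⟪e, p⟫ = 0 := by rw [real_inner_comm]; exact hpe
  have hc : HasDerivAt (fun t => Real.cos t - 1) (-Real.sin τ) τ :=
    (Real.hasDerivAt_cos τ).sub_const 1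
  have hs := Real.hasDerivAt_sin τ
  have := ((((hc.smul_const p).add (hs.smul_const e)).const_smul ⟪p, x⟫).add
    (((hc.smul_const e).sub (hs.smul_const p)).const_smul ⟪e, x⟫)).const_add x
  simp only [planeRot_apply]
  refine (this.congr_deriv ?_)
  rw [rotGen_apply]
  simp only [inner_add_right, inner_sub_right, inner_smul_right, hpp, hee, hep, hpe]
  module

lemma norm_planeRot (hp : ‖p‖ = 1) (he : ‖e‖ = 1) (hpe : ⟪p, e⟫ = 0) (τ : ℝ) (x : E) :
    ‖planeRot p e τ x‖ = ‖x‖ := by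
  have hpp : ⟪p, p⟫ = 1 := by simp [hp]
  have hee : ⟪e, e⟫ = 1 := by simp [he]
  have hep : ⟪e, p⟫ = 0 := by rw [real_inner_comm]; exact hpe
  have hxp : ⟪x, p⟫ = ⟪p, x⟫ := real_inner_comm _ _
  have hxe : ⟪x, e⟫ = ⟪e, x⟫ := real_inner_comm _ _
  have h : ‖planeRot p e τ x‖ ^ 2 = ‖x‖ ^ 2 := by
    rw [← real_inner_self_eq_norm_sq, ← real_inner_self_eq_norm_sq, planeRot_apply]
    simp only [inner_add_right, inner_sub_right, inner_smul_right, inner_add_left, inner_sub_left,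
      inner_smul_left, hpp, hee, hep, hpe, hxp, hxe, conj_trivial]
    linear_combination (⟪p, x⟫ ^ 2 + ⟪e, x⟫ ^ 2) * (Real.sin_sq_add_cos_sq τ)
  exact (pow_left_inj₀ (norm_nonneg _) (norm_nonneg _) two_ne_zero).1 h

lemma norm_planeRot_sub_le (hp : ‖p‖ = 1) (he : ‖e‖ = 1) (hpe : ⟪p, e⟫ = 0) (x : E) (s t : ℝ) :
    ‖planeRot p e t x - planeRot p e s x‖ ≤ 2 * ‖x‖ * |t - s| := by
  have := Convex.norm_image_sub_le_of_norm_hasDerivWithin_le (f := fun t => planeRot p e t x)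
    (C := 2 * ‖x‖) (s := Set.univ) (x := s) (y := t)
    (fun τ _ => (hasDerivAt_planeRot hp he hpe x τ).hasDerivWithinAt)
    (fun τ _ => (norm_rotGen_le hp he _).trans (by rw [norm_planeRot hp he hpe]))
    convex_univ trivial trivial
  simpa using this

end Rotation

/-! ### The surface measure of the unit sphere -/

section SphereMeasure

variable {E : Type*} [NormedAddCommGroup E] [InnerProductSpace ℝ E]

/-- The self-map of the unit sphere induced by a norm-preserving linear map. -/
def sphereMap (L : E →L[ℝ] E) (hL : ∀ x, ‖L x‖ = ‖x‖) (θ : Metric.sphere (0 : E) 1) :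
    Metric.sphere (0 : E) 1 :=
  ⟨L θ, by simp [hL]⟩

lemma continuous_sphereMap (L : E →L[ℝ] E) (hL : ∀ x, ‖L x‖ = ‖x‖) :
    Continuous (sphereMap L hL) := by
  unfold sphereMap
  fun_prop

variable [FiniteDimensional ℝ E] [MeasurableSpace E] [BorelSpace E]

open scoped Pointwise in
lemma measurePreserving_sphereMap (L : E →L[ℝ] E) (hL : ∀ x, ‖L x‖ = ‖x‖) :
    MeasurePreserving (sphereMap L hL) (volume : Measure E).toSphere
      (volume : Measure E).toSphere := by
  have hmeas := (continuous_sphereMap L hL).measurable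
  refine ⟨hmeas, ?_⟩
  ext s hs
  rw [Measure.map_apply hmeas hs, Measure.toSphere_apply' _ (hmeas hs),
    Measure.toSphere_apply' _ hs]
  let Li : E →ₗᵢ[ℝ] E := ⟨L.toLinearMap, hL⟩
  let Le : E ≃ₗᵢ[ℝ] E := Li.toLinearIsometryEquiv rfl
  have hLe : ∀ x, Le x = L x := fun x => rfl
  have hset : Set.Ioo (0 : ℝ) 1 • (Subtype.val '' (sphereMap L hL ⁻¹' s)) =
      Le ⁻¹' (Set.Ioo (0 : ℝ) 1 • (Subtype.val '' s)) := by
    ext x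
    simp only [Set.mem_smul, Set.mem_image, Set.mem_preimage]
    constructor
    · rintro ⟨t, ht, _, ⟨θ, hθ, rfl⟩, rfl⟩
      exact ⟨t, ht, _, ⟨_, hθ, rfl⟩, by simp [hLe, sphereMap]⟩
    · rintro ⟨t, ht, _, ⟨θ, hθ, rfl⟩, hx⟩
      refine ⟨t, ht, _, ⟨⟨Le.symm θ, by simp⟩, ?_, rfl⟩, ?_⟩
      · have hθ' : sphereMap L hL ⟨Le.symm θ, by simp⟩ = θ := by
          ext1
          simp [sphereMap, ← hLe]
        exact hθ'.symm ▸ hθ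
      · apply Le.injective
        simp [← hx]
  rw [hset]
  congr 1
  exact Le.measurePreserving.measure_preimage_equiv (f := Le.toMeasurableEquiv) _

lemma integrable_average (p e : E) {k : ℝ → ℝ} (hk : Continuous k) {G : E → ℝ}
    (hG : Measurable G) (hG1 : ∀ x, |G x| ≤ 1) (T : ℝ) :
    Integrable (fun z : Metric.sphere (0 : E) 1 × ℝ => k z.2 * G (planeRot p e z.2 (z.1 : E)))
      ((volume : Measure E).toSphere.prod (volume.restrict (Set.Ioc (-T) T))) := by
  have hmeas : Measurable fun z : Metric.sphere (0 : E) 1 × ℝ =>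
      k z.2 * G (planeRot p e z.2 (z.1 : E)) := by
    refine (hk.measurable.comp measurable_snd).mul (hG.comp ?_)
    exact ((continuous_planeRot p e).comp
      (continuous_snd.prodMk (continuous_subtype_val.comp continuous_fst))).measurable
  obtain ⟨C, hC⟩ := (isCompact_Icc (a := -T) (b := T)).exists_bound_of_continuousOn hk.continuousOn
  refine Integrable.mono' (g := fun _ => C) (integrable_const C) hmeas.aestronglyMeasurable ?_
  have : ∀ᵐ z ∂((volume : Measure E).toSphere.prod (volume.restrict (Set.Ioc (-T) T))),
      z.2 ∈ Set.Ioc (-T) T :=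
    Measure.quasiMeasurePreserving_snd.ae (ae_restrict_mem measurableSet_Ioc)
  filter_upwards [this] with z hz
  rw [norm_mul]
  have h1 := hC z.2 (Set.Ioc_subset_Icc_self hz)
  have h2 := hG1 (planeRot p e z.2 (z.1 : E))
  rw [Real.norm_eq_abs (G _)]
  nlinarith [norm_nonneg (k z.2), abs_nonneg (G (planeRot p e z.2 (z.1 : E)))]

/-- Averaging over rotations: by invariance of the surface measure, an integral over the sphere is
not changed if the integrand is replaced by its weighted mean along the orbits of a one-parameter
family of rotations. -/
lemma integral_sphere_eq_average {p e : E} (hp : ‖p‖ = 1) (he : ‖e‖ = 1) (hpe : inner ℝ p e = 0)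
    {k : ℝ → ℝ} (hk : Continuous k) {G : E → ℝ} (hG : Measurable G) (hG1 : ∀ x, |G x| ≤ 1)
    (T : ℝ) :
    (∫ τ in Set.Ioc (-T) T, k τ) * ∫ θ, G (θ : E) ∂(volume : Measure E).toSphere =
      ∫ θ, (∫ τ in Set.Ioc (-T) T, k τ * G (planeRot p e τ (θ : E)))
        ∂(volume : Measure E).toSphere := by
  rw [integral_integral_swap (integrable_average p e hk hG hG1 T), ← integral_mul_const]
  congr 1
  ext τ
  rw [integral_const_mul]
  congr 1
  have hmp := measurePreserving_sphereMap (planeRot p e τ) (norm_planeRot hp he hpe τ)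
  have h := integral_map (μ := (volume : Measure E).toSphere) hmp.measurable.aemeasurable
    (f := fun θ => G (θ : E)) (hG.comp measurable_subtype_coe).aestronglyMeasurable
  rw [hmp.map_eq] at h
  exact h

end SphereMeasure

/-! ### First-order expansions with a Hölder remainder -/

/-- `A r = a + b (r - 1) + O(|r - 1| ^ (1 + β))` as `r → 1`. -/
def ExpandsAtOne (β : ℝ) (A : ℝ → ℝ) : Prop :=
  ∃ a b : ℝ, (fun r => A r - a - b * (r - 1)) =O[𝓝 1] fun r => |r - 1| ^ (1 + β)

lemma ExpandsAtOne.congr {β : ℝ} {A B : ℝ → ℝ} (hA : ExpandsAtOne β A) (h : A =ᶠ[𝓝 1] B) :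
    ExpandsAtOne β B := by
  obtain ⟨a, b, hab⟩ := hA
  refine ⟨a, b, hab.congr' ?_ EventuallyEq.rfl⟩
  filter_upwards [h] with r hr
  rw [hr]

lemma expandsAtOne_const (β c : ℝ) : ExpandsAtOne β fun _ => c :=
  ⟨c, 0, by simpa using Asymptotics.isBigO_zero _ _⟩

lemma ExpandsAtOne.const_mul {β : ℝ} {A : ℝ → ℝ} (hA : ExpandsAtOne β A) (c : ℝ) :
    ExpandsAtOne β fun r => c * A r := by
  obtain ⟨a, b, hab⟩ := hA
  refine ⟨c * a, c * b, (hab.const_mul_left c).congr_left fun r => ?_⟩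
  ring

lemma ExpandsAtOne.sum {β : ℝ} {ι : Type*} (s : Finset ι) {A : ι → ℝ → ℝ}
    (hA : ∀ i ∈ s, ExpandsAtOne β (A i)) : ExpandsAtOne β fun r => ∑ i ∈ s, A i r := by
  classical
  induction s using Finset.induction_on with
  | empty => simpa using expandsAtOne_const β 0
  | insert i s hi ih =>
    obtain ⟨a, b, h1⟩ := hA i (Finset.mem_insert_self _ _)
    obtain ⟨a', b', h2⟩ := ih fun j hj => hA j (Finset.mem_insert_of_mem hj)
    refine ⟨a + a', b + b', (h1.add h2).congr_left fun r => ?_⟩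
    simp only [Finset.sum_insert hi]
    ring

/-- Expansions with a uniform remainder can be integrated over a parameter. -/
lemma expandsAtOne_integral {Θ : Type*} [MeasurableSpace Θ] {μ : Measure Θ} [IsFiniteMeasure μ]
    {β : ℝ} (hβ : 0 < β) {B : ℝ → Θ → ℝ} {C δ : ℝ} (hδ : 0 < δ)
    (hB : ∀ r, |r - 1| < δ → Integrable (B r) μ)
    (hexp : ∀ θ, ∃ D : ℝ, ∀ r, |r - 1| < δ →
      |B r θ - B 1 θ - D * (r - 1)| ≤ C * |r - 1| ^ (1 + β)) :
    ExpandsAtOne β fun r => ∫ θ, B r θ ∂μ := by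
  choose D hD using hexp
  have h1 : |(1 : ℝ) - 1| < δ := by simpa using hδ
  -- `D` is the limit of difference quotients along `1 + δ / (n + 2)`, hence measurable.
  have hseq : Tendsto (fun n : ℕ => δ / ((n : ℝ) + 2)) atTop (𝓝[>] 0) := by
    refine tendsto_nhdsWithin_iff.2 ⟨?_, Eventually.of_forall fun n => ?_⟩
    · exact Tendsto.div_atTop tendsto_const_nhds
        (tendsto_atTop_add_const_right _ _ tendsto_natCast_atTop_atTop)
    · exact div_pos hδ (by positivity)
  have hlt : ∀ n : ℕ, δ / ((n : ℝ) + 2) < δ := fun n =>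
    div_lt_self hδ (by have : (0 : ℝ) ≤ n := n.cast_nonneg; linarith)
  have hpos : ∀ n : ℕ, 0 < δ / ((n : ℝ) + 2) := fun n => by positivity
  have hr : ∀ n : ℕ, |1 + δ / ((n : ℝ) + 2) - 1| < δ := fun n => by
    rw [add_sub_cancel_left, abs_of_pos (hpos n)]
    exact hlt n
  have hquot : ∀ (θ : Θ) (n : ℕ),
      |(B (1 + δ / ((n : ℝ) + 2)) θ - B 1 θ) / (δ / ((n : ℝ) + 2)) - D θ| ≤
        C * (δ / ((n : ℝ) + 2)) ^ β := by
    intro θ n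
    have := hD θ _ (hr n)
    rw [add_sub_cancel_left, abs_of_pos (hpos n), Real.rpow_add (hpos n), Real.rpow_one] at this
    set s := δ / ((n : ℝ) + 2)
    have hs : 0 < s := hpos n
    have he : (B (1 + s) θ - B 1 θ) / s - D θ = (B (1 + s) θ - B 1 θ - D θ * s) / s := by
      field_simp
    rw [he, abs_div, abs_of_pos hs, div_le_iff₀ hs]
    linarith
  have hpow : Tendsto (fun n : ℕ => C * (δ / ((n : ℝ) + 2)) ^ β) atTop (𝓝 0) := by
    have h0 : Tendsto (fun s : ℝ => C * s ^ β) (𝓝 0) (𝓝 (C * 0 ^ β)) :=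
      ((Real.continuousAt_rpow_const 0 β (Or.inr hβ.le)).tendsto).const_mul C
    rw [Real.zero_rpow hβ.ne', mul_zero] at h0
    exact h0.comp (hseq.mono_right nhdsWithin_le_nhds)
  have hDmeas : AEStronglyMeasurable D μ := by
    refine aestronglyMeasurable_of_tendsto_ae atTop
      (f := fun (n : ℕ) θ => (B (1 + δ / ((n : ℝ) + 2)) θ - B 1 θ) / (δ / ((n : ℝ) + 2)))
      (fun n => ?_) (Eventually.of_forall fun θ => ?_)
    · simpa [div_eq_mul_inv] using
        (((hB _ (hr n)).sub (hB 1 h1)).mul_const (δ / ((n : ℝ) + 2))⁻¹).aestronglyMeasurable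
    · rw [tendsto_iff_norm_sub_tendsto_zero]
      exact squeeze_zero (fun n => norm_nonneg _) (hquot θ) hpow
  have hDint : Integrable D μ := by
    have h2 : Integrable (fun θ => (B (1 + δ / ((0 : ℕ) + 2)) θ - B 1 θ) /
        (δ / (((0 : ℕ) : ℝ) + 2))) μ := ((hB _ (hr 0)).sub (hB 1 h1)).div_const _
    refine (h2.norm.add (integrable_const (C * (δ / (((0 : ℕ) : ℝ) + 2)) ^ β))).mono' hDmeas
      (Eventually.of_forall fun θ => ?_)
    have h3 := hquot θ 0
    have h4 := abs_sub_abs_le_abs_sub (D θ)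
      ((B (1 + δ / (((0 : ℕ) : ℝ) + 2)) θ - B 1 θ) / (δ / (((0 : ℕ) : ℝ) + 2)))
    rw [abs_sub_comm] at h4
    simp only [Real.norm_eq_abs, Pi.add_apply]
    linarith
  refine ⟨∫ θ, B 1 θ ∂μ, ∫ θ, D θ ∂μ, Asymptotics.IsBigO.of_bound (C * μ.real Set.univ) ?_⟩
  filter_upwards [Metric.ball_mem_nhds (1 : ℝ) hδ] with r hr
  rw [Metric.mem_ball, Real.dist_eq] at hr
  rw [← integral_sub (hB r hr) (hB 1 h1), ← integral_mul_const,
    ← integral_sub (by exact (hB r hr).sub (hB 1 h1)) (hDint.mul_const _)]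
  refine (norm_integral_le_of_norm_le_const (C := C * |r - 1| ^ (1 + β))
    (Eventually.of_forall fun θ => ?_)).trans (le_of_eq ?_)
  · exact hD θ r hr
  · rw [Real.norm_eq_abs, abs_of_nonneg (Real.rpow_nonneg (abs_nonneg _) _)]
    ring

/-! ### The zero of an increasing function depending on a parameter -/

/-- A quantitative implicit function theorem at `r = 1`. If `g r` is increasing on `[-T, T]` with a
sign change, then its zero `h r` has an expansion `h 1 + D (r - 1) + O(|r - 1| ^ (1 + α))`, and the
constants of the remainder depend only on the bounds for `g`. -/
lemma exists_zero_expansion {g g' : ℝ → ℝ → ℝ} {a : ℝ → ℝ} {α δ T c M C₁ C₂ : ℝ}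
    (hα : 0 < α) (hδ : 0 < δ) (hδ1 : δ ≤ 1) (hT : 0 < T) (hc : 0 < c) (hM : 0 ≤ M) (hC₁ : 0 ≤ C₁)
    (hC₂ : 0 ≤ C₂)
    (hg : ∀ r, |r - 1| < δ → ∀ τ ∈ Set.Icc (-T) T, HasDerivAt (g r) (g' r τ) τ)
    (hcg : ∀ r, |r - 1| < δ → ∀ τ ∈ Set.Icc (-T) T, c ≤ g' r τ)
    (ha : ∀ τ ∈ Set.Icc (-T) T, |a τ| ≤ M)
    (hr : ∀ r, |r - 1| < δ → ∀ τ ∈ Set.Icc (-T) T,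
      |g r τ - g 1 τ - a τ * (r - 1)| ≤ C₁ * |r - 1| ^ (1 + α))
    (hH : ∀ r, |r - 1| < δ → ∀ τ ∈ Set.Icc (-T) T, ∀ τ' ∈ Set.Icc (-T) T,
      |g' r τ - g' 1 τ'| ≤ C₂ * (|r - 1| + |τ - τ'|) ^ α)
    (hneg : ∀ r, |r - 1| < δ → g r (-T) < 0) (hpos : ∀ r, |r - 1| < δ → 0 < g r T) :
    ∃ (h : ℝ → ℝ) (D : ℝ), ∀ r, |r - 1| < δ →
      h r ∈ Set.Ioo (-T) T ∧
      (∀ τ ∈ Set.Icc (-T) T, τ < h r → g r τ < 0) ∧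
      (∀ τ ∈ Set.Icc (-T) T, h r < τ → 0 < g r τ) ∧
      |h r - h 1| ≤ (M + C₁) / c * |r - 1| ∧
      |h r - h 1 - D * (r - 1)| ≤
        (C₁ / c + M * C₂ * (1 + (M + C₁) / c) ^ α / c ^ 2) * |r - 1| ^ (1 + α) := by
  have hmono : ∀ r, |r - 1| < δ → StrictMonoOn (g r) (Set.Icc (-T) T) := by
    intro r h
    refine strictMonoOn_of_deriv_pos (convex_Icc _ _)
      (fun τ hτ => (hg r h τ hτ).continuousAt.continuousWithinAt) fun τ hτ => ?_
    rw [interior_Icc] at hτ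
    have hτ' := Set.Ioo_subset_Icc_self hτ
    rw [(hg r h τ hτ').deriv]
    exact hc.trans_le (hcg r h τ hτ')
  have hzero : ∀ r, ∃ τ, |r - 1| < δ → τ ∈ Set.Ioo (-T) T ∧ g r τ = 0 := by
    intro r
    by_cases h : |r - 1| < δ
    · have hcont : ContinuousOn (g r) (Set.Icc (-T) T) :=
        fun τ hτ => (hg r h τ hτ).continuousAt.continuousWithinAt
      obtain ⟨τ, hτ, h0⟩ := intermediate_value_Ioo (by linarith : -T ≤ T) hcont
        (show (0 : ℝ) ∈ Set.Ioo (g r (-T)) (g r T) from ⟨hneg r h, hpos r h⟩)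
      exact ⟨τ, fun _ => ⟨hτ, h0⟩⟩
    · exact ⟨0, fun h' => absurd h' h⟩
  choose h hh using hzero
  have h11 : |(1 : ℝ) - 1| < δ := by simpa using hδ
  obtain ⟨hmem1, hz1⟩ := hh 1 h11
  have hmem1' := Set.Ioo_subset_Icc_self hmem1
  refine ⟨h, -a (h 1) / g' 1 (h 1), fun r hrδ => ?_⟩
  obtain ⟨hmem, hz⟩ := hh r hrδ
  have hmem' := Set.Ioo_subset_Icc_self hmem
  set s := r - 1 with hs
  have hs1 : |s| ≤ 1 := hrδ.le.trans hδ1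
  -- mean value theorem in the second variable
  obtain ⟨ξ, hξ, hξd, hmvt⟩ : ∃ ξ ∈ Set.Icc (-T) T, |ξ - h 1| ≤ |h r - h 1| ∧
      g r (h r) - g r (h 1) = g' r ξ * (h r - h 1) := by
    rcases lt_trichotomy (h 1) (h r) with hlt | heq | hlt
    · have hsub : Set.Icc (h 1) (h r) ⊆ Set.Icc (-T) T := Set.Icc_subset_Icc hmem1.1.le hmem.2.le
      obtain ⟨ξ, hξ, he⟩ := exists_hasDerivAt_eq_slope (g r) (g' r) hlt
        (fun τ hτ => (hg r hrδ τ (hsub hτ)).continuousAt.continuousWithinAt)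
        (fun τ hτ => hg r hrδ τ (hsub (Set.Ioo_subset_Icc_self hτ)))
      refine ⟨ξ, hsub (Set.Ioo_subset_Icc_self hξ), ?_, ?_⟩
      · rw [abs_of_pos (by linarith [hξ.1]), abs_of_pos (by linarith)]
        linarith [hξ.2]
      · rw [he]
        field_simp [(sub_pos.2 hlt).ne']
    · exact ⟨h 1, hmem1', by simp, by simp [heq]⟩
    · have hsub : Set.Icc (h r) (h 1) ⊆ Set.Icc (-T) T := Set.Icc_subset_Icc hmem.1.le hmem1.2.le
      obtain ⟨ξ, hξ, he⟩ := exists_hasDerivAt_eq_slope (g r) (g' r) hlt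
        (fun τ hτ => (hg r hrδ τ (hsub hτ)).continuousAt.continuousWithinAt)
        (fun τ hτ => hg r hrδ τ (hsub (Set.Ioo_subset_Icc_self hτ)))
      refine ⟨ξ, hsub (Set.Ioo_subset_Icc_self hξ), ?_, ?_⟩
      · rw [abs_of_neg (by linarith [hξ.2]), abs_of_neg (by linarith)]
        linarith [hξ.1]
      · have hne := (sub_pos.2 hlt).ne'
        rw [eq_div_iff hne] at he
        linarith
  have hpow : |s| ^ (1 + α) = |s| * |s| ^ α := by
    rcases eq_or_ne s 0 with h0 | h0
    · simp [h0, Real.zero_rpow (by linarith : 1 + α ≠ 0)]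
    · rw [Real.rpow_add (abs_pos.2 h0), Real.rpow_one]
  have hpowle : |s| ^ α ≤ 1 := Real.rpow_le_one (abs_nonneg _) hs1 hα.le
  have hpow0 : 0 ≤ |s| ^ α := Real.rpow_nonneg (abs_nonneg _) _
  have hE := hr r hrδ (h 1) hmem1'
  rw [hz1, sub_zero] at hE
  rw [hz, zero_sub] at hmvt
  have hcξ := hcg r hrδ ξ hξ
  have hc1 := hcg 1 h11 (h 1) hmem1'
  have haM := ha (h 1) hmem1'
  have hL : |h r - h 1| ≤ (M + C₁) / c * |s| := by
    rw [div_mul_eq_mul_div, le_div_iff₀ hc]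
    calc |h r - h 1| * c ≤ |h r - h 1| * g' r ξ := by gcongr
      _ = |g r (h 1)| := by
        rw [← abs_neg (g r (h 1)), hmvt, abs_mul, abs_of_pos (hc.trans_le hcξ), mul_comm]
      _ ≤ |g r (h 1) - a (h 1) * s| + |a (h 1) * s| := by
        have := abs_add_le (g r (h 1) - a (h 1) * s) (a (h 1) * s)
        simpa using this
      _ ≤ C₁ * |s| ^ (1 + α) + M * |s| := by
        rw [abs_mul]
        gcongr
      _ ≤ (M + C₁) * |s| := by
        rw [hpow]
        nlinarith [mul_nonneg hC₁ (abs_nonneg s)]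
  refine ⟨hmem, fun τ hτ hlt => ?_, fun τ hτ hlt => ?_, hL, ?_⟩
  · rw [← hz]
    exact hmono r hrδ hτ hmem' hlt
  · rw [← hz]
    exact hmono r hrδ hmem' hτ hlt
  have hξ0 : 0 < g' r ξ := hc.trans_le hcξ
  have h10 : 0 < g' 1 (h 1) := hc.trans_le hc1
  have hL0 : 0 ≤ (M + C₁) / c := by positivity
  have hid : h r - h 1 - -a (h 1) / g' 1 (h 1) * s =
      -(g r (h 1) - a (h 1) * s) / g' r ξ +
        a (h 1) * s * (g' r ξ - g' 1 (h 1)) / (g' r ξ * g' 1 (h 1)) := by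
    have : h r - h 1 = -g r (h 1) / g' r ξ := by
      rw [hmvt]
      field_simp
    rw [this]
    field_simp
    ring
  have hΦ : |g' r ξ - g' 1 (h 1)| ≤ C₂ * ((1 + (M + C₁) / c) ^ α * |s| ^ α) := by
    refine (hH r hrδ ξ hξ (h 1) hmem1').trans ?_
    rw [← Real.mul_rpow (by linarith) (abs_nonneg _)]
    gcongr
    calc |s| + |ξ - h 1| ≤ |s| + (M + C₁) / c * |s| := by linarith
      _ = _ := by ring
  rw [hid]
  calc _ ≤ |(-(g r (h 1) - a (h 1) * s)) / g' r ξ| +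
        |a (h 1) * s * (g' r ξ - g' 1 (h 1)) / (g' r ξ * g' 1 (h 1))| := abs_add_le _ _
    _ ≤ C₁ * |s| ^ (1 + α) / c +
        M * |s| * (C₂ * ((1 + (M + C₁) / c) ^ α * |s| ^ α)) / (c * c) := by
      rw [abs_div, abs_neg, abs_div, abs_mul, abs_mul, abs_mul, abs_of_pos hξ0, abs_of_pos h10]
      gcongr
    _ = _ := by
      rw [hpow]
      ring

/-- The integral of a Lipschitz function against a step function whose jump `h r` has a first-order
expansion at `r = 1` has a first-order expansion as well. -/
lemma step_integral_expansion {q : ℝ → ℝ} {K : ℝ≥0} {Q : ℝ} (hq : LipschitzWith K q)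
    (hQ : ∀ t, |q t| ≤ Q) {T δ α L C D cm cp : ℝ} (hα1 : α ≤ 1) (hδ : 0 < δ) (hδ1 : δ ≤ 1)
    (hcm : |cm - cp| ≤ 1) {h : ℝ → ℝ} {χ : ℝ → ℝ → ℝ}
    (hh : ∀ r, |r - 1| < δ → h r ∈ Set.Ioo (-T) T)
    (hlt : ∀ r, |r - 1| < δ → ∀ τ ∈ Set.Icc (-T) T, τ < h r → χ r τ = cm)
    (hgt : ∀ r, |r - 1| < δ → ∀ τ ∈ Set.Icc (-T) T, h r < τ → χ r τ = cp)
    (hhL : ∀ r, |r - 1| < δ → |h r - h 1| ≤ L * |r - 1|)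
    (hhD : ∀ r, |r - 1| < δ → |h r - h 1 - D * (r - 1)| ≤ C * |r - 1| ^ (1 + α))
    {r : ℝ} (hr : |r - 1| < δ) :
    |(∫ τ in Set.Ioc (-T) T, q τ * χ r τ) - (∫ τ in Set.Ioc (-T) T, q τ * χ 1 τ) -
      (cm - cp) * q (h 1) * D * (r - 1)| ≤ (K * L ^ 2 + Q * C) * |r - 1| ^ (1 + α) := by
  have hqc : Continuous q := hq.continuous
  have hii : ∀ x y, IntervalIntegrable q volume x y := fun x y => hqc.intervalIntegrable x y
  have key : ∀ r, |r - 1| < δ → ∫ τ in Set.Ioc (-T) T, q τ * χ r τ =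
      cm * (∫ τ in (-T)..(h r), q τ) + cp * ∫ τ in (h r)..T, q τ := by
    intro r hr
    obtain ⟨h1, h2⟩ := hh r hr
    have e1 : Set.EqOn (fun τ => q τ * χ r τ) (fun τ => cm * q τ) (Set.Ioo (-T) (h r)) := by
      intro τ hτ
      simp only
      rw [hlt r hr τ ⟨hτ.1.le, (hτ.2.trans h2).le⟩ hτ.2, mul_comm]
    have e2 : Set.EqOn (fun τ => q τ * χ r τ) (fun τ => cp * q τ) (Set.Ioc (h r) T) := by
      intro τ hτ
      simp only
      rw [hgt r hr τ ⟨(h1.trans hτ.1).le, hτ.2⟩ hτ.1, mul_comm]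
    have i1 : IntegrableOn (fun τ => q τ * χ r τ) (Set.Ioc (-T) (h r)) := by
      rw [integrableOn_Ioc_iff_integrableOn_Ioo]
      refine IntegrableOn.congr_fun ?_ e1.symm measurableSet_Ioo
      exact ((hii (-T) (h r)).1.mono_set Set.Ioo_subset_Ioc_self).const_mul cm
    have i2 : IntegrableOn (fun τ => q τ * χ r τ) (Set.Ioc (h r) T) := by
      refine IntegrableOn.congr_fun ?_ e2.symm measurableSet_Ioc
      exact ((hii (h r) T).1).const_mul cp
    rw [← Set.Ioc_union_Ioc_eq_Ioc h1.le h2.le, setIntegral_union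
      (Set.Ioc_disjoint_Ioc_of_le le_rfl) measurableSet_Ioc i1 i2,
      integral_Ioc_eq_integral_Ioo, setIntegral_congr_fun measurableSet_Ioo e1,
      setIntegral_congr_fun measurableSet_Ioc e2, integral_const_mul, integral_const_mul,
      ← integral_Ioc_eq_integral_Ioo, ← intervalIntegral.integral_of_le h1.le,
      ← intervalIntegral.integral_of_le h2.le]
  have h11 : |(1 : ℝ) - 1| < δ := by simpa using hδ
  have hs1 : |r - 1| ≤ 1 := hr.le.trans hδ1
  have hQ0 : 0 ≤ Q := (abs_nonneg _).trans (hQ 0)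
  have hdiff : (∫ τ in Set.Ioc (-T) T, q τ * χ r τ) - (∫ τ in Set.Ioc (-T) T, q τ * χ 1 τ) =
      (cm - cp) * ∫ τ in (h 1)..(h r), q τ := by
    rw [key r hr, key 1 h11, ← intervalIntegral.integral_add_adjacent_intervals
      (hii (-T) (h 1)) (hii (h 1) (h r)), ← intervalIntegral.integral_add_adjacent_intervals
      (hii (h 1) (h r)) (hii (h r) T)]
    ring
  have hrem : |(∫ τ in (h 1)..(h r), q τ) - q (h 1) * (h r - h 1)| ≤ K * |h r - h 1| ^ 2 := by
    have : (∫ τ in (h 1)..(h r), q τ) - q (h 1) * (h r - h 1) =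
        ∫ τ in (h 1)..(h r), (q τ - q (h 1)) := by
      rw [intervalIntegral.integral_sub (hii _ _) (by simp), intervalIntegral.integral_const,
        smul_eq_mul, mul_comm (h r - h 1)]
    rw [this, ← Real.norm_eq_abs, sq, ← mul_assoc]
    refine intervalIntegral.norm_integral_le_of_norm_le_const fun τ hτ => ?_
    rw [← dist_eq_norm]
    refine (hq.dist_le_mul _ _).trans ?_
    rw [Real.dist_eq]
    exact mul_le_mul_of_nonneg_left
      (Set.abs_sub_left_of_mem_uIcc (Set.uIoc_subset_uIcc hτ)) K.2
  have hsq : |r - 1| ^ 2 ≤ |r - 1| ^ (1 + α) := by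
    rcases eq_or_ne (r - 1) 0 with h0 | h0
    · rw [h0]
      simp only [abs_zero]
      have : (0 : ℝ) ≤ 0 ^ (1 + α) := Real.rpow_nonneg le_rfl _
      simpa using this
    · rw [← Real.rpow_natCast]
      exact Real.rpow_le_rpow_of_exponent_ge (abs_pos.2 h0) hs1 (by push_cast; linarith)
  rw [hdiff]
  have hid : (cm - cp) * (∫ τ in (h 1)..(h r), q τ) - (cm - cp) * q (h 1) * D * (r - 1) =
      (cm - cp) * (((∫ τ in (h 1)..(h r), q τ) - q (h 1) * (h r - h 1)) +
        q (h 1) * (h r - h 1 - D * (r - 1))) := by ring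
  rw [hid, abs_mul]
  have hLs := hhL r hr
  calc _ ≤ 1 * (|(∫ τ in (h 1)..(h r), q τ) - q (h 1) * (h r - h 1)| +
        |q (h 1) * (h r - h 1 - D * (r - 1))|) := by
        gcongr
        exact abs_add_le _ _
    _ ≤ K * |h r - h 1| ^ 2 + Q * (C * |r - 1| ^ (1 + α)) := by
        rw [one_mul, abs_mul]
        gcongr
        · exact hQ _
        · exact hhD r hr
    _ ≤ K * (L * |r - 1|) ^ 2 + Q * (C * |r - 1| ^ (1 + α)) := by gcongr
    _ = K * L ^ 2 * |r - 1| ^ 2 + Q * (C * |r - 1| ^ (1 + α)) := by ring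
    _ ≤ K * L ^ 2 * |r - 1| ^ (1 + α) + Q * (C * |r - 1| ^ (1 + α)) := by gcongr
    _ = _ := by ring

/-! ### Crossing a transversal surface along rotations -/

section LocalGeometry

open scoped RealInnerProductSpace

/-- A surface transversal to the unit sphere at `p` is crossed by some unit vector tangent to the
sphere. -/
lemma exists_tangent_fderiv_pos {f : K3 → ℝ} {p : K3} (h : IsTransversalAt f p) :
    ∃ e : K3, ‖e‖ = 1 ∧ ⟪p, e⟫ = 0 ∧ 0 < fderiv ℝ f p e := by
  obtain ⟨h0, hsup⟩ := h
  obtain ⟨v, hv, hfv⟩ : ∃ v ∈ (Submodule.span ℝ {p})ᗮ, fderiv ℝ f p v ≠ 0 := by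
    by_contra! hcon
    have hle : (Submodule.span ℝ {p})ᗮ ≤ (fderiv ℝ f p).toLinearMap.ker := fun v hv => hcon v hv
    rw [sup_eq_left.2 hle] at hsup
    apply h0
    ext x
    have : x ∈ (fderiv ℝ f p).toLinearMap.ker := hsup ▸ Submodule.mem_top
    simpa using this
  rw [Submodule.mem_orthogonal_singleton_iff_inner_right] at hv
  have hv0 : v ≠ 0 := fun h => hfv (by simp [h])
  rcases lt_or_gt_of_ne hfv with hneg | hpos
  · refine ⟨-(‖v‖⁻¹ • v), ?_, ?_, ?_⟩
    · rw [norm_neg, norm_smul, norm_inv, norm_norm, inv_mul_cancel₀ (norm_ne_zero_iff.2 hv0)]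
    · rw [inner_neg_right, inner_smul_right, hv, mul_zero, neg_zero]
    · rw [map_neg, map_smul, smul_eq_mul, ← mul_neg]
      exact mul_pos (inv_pos.2 (norm_pos_iff.2 hv0)) (neg_pos.2 hneg)
  · refine ⟨‖v‖⁻¹ • v, ?_, ?_, ?_⟩
    · rw [norm_smul, norm_inv, norm_norm, inv_mul_cancel₀ (norm_ne_zero_iff.2 hv0)]
    · rw [inner_smul_right, hv, mul_zero]
    · rw [map_smul, smul_eq_mul]
      exact mul_pos (inv_pos.2 (norm_pos_iff.2 hv0)) hpos

lemma abs_sub_sub_fderiv_le {E : Type*} [NormedAddCommGroup E] [NormedSpace ℝ E] {f : E → ℝ}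
    {s : Set E} (hs : Convex ℝ s) {C α : ℝ≥0} (hd : ∀ x ∈ s, DifferentiableAt ℝ f x)
    (hH : HolderOnWith C α (fderiv ℝ f) s) {x y : E} (hx : x ∈ s) (hy : y ∈ s) :
    |f y - f x - fderiv ℝ f x (y - x)| ≤ C * ‖y - x‖ ^ (1 + α : ℝ) := by
  have hseg := hs.segment_subset hx hy
  have := Convex.norm_image_sub_le_of_norm_fderiv_le' (f := f) (φ := fderiv ℝ f x)
    (C := C * ‖y - x‖ ^ (α : ℝ)) (fun z hz => hd z (hseg hz)) (fun z hz => ?_)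
    (convex_segment x y) (left_mem_segment ℝ x y) (right_mem_segment ℝ x y)
  · refine this.trans (le_of_eq ?_)
    rcases eq_or_ne (‖y - x‖) 0 with h0 | h0
    · rw [h0, Real.zero_rpow (x := 1 + (α : ℝ)) (by positivity)]
      simp
    · rw [Real.rpow_add ((norm_nonneg _).lt_of_ne' h0), Real.rpow_one]
      ring
  · rw [← dist_eq_norm]
    refine hH.dist_le_of_le (hseg hz) hx ?_
    rw [dist_eq_norm]
    exact norm_sub_le_of_mem_segment hz

lemma IsPreconnected.mem_interior_iff {X : Type*} [TopologicalSpace X] {U t : Set X}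
    (ht : IsPreconnected t) (hd : Disjoint t (frontier U)) {x y : X} (hx : x ∈ t) (hy : y ∈ t) :
    x ∈ interior U ↔ y ∈ interior U := by
  have key : ∀ {x y}, x ∈ t → y ∈ t → x ∈ interior U → y ∈ interior U := by
    intro x y hx hy hxU
    refine ht.subset_left_of_subset_union isOpen_interior isClosed_closure.isOpen_compl
      (Set.disjoint_compl_right_iff_subset.2 interior_subset_closure) (fun z hz => ?_)
      ⟨x, hx, hxU⟩ hy
    by_contra hcon
    rw [Set.mem_union, Set.mem_compl_iff, not_or, not_not] at hcon
    exact Set.disjoint_left.1 hd hz ⟨hcon.2, hcon.1⟩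
  exact ⟨key hx hy, key hy hx⟩

/-- Near a point `p` of the sphere where the frontier of `U` is a transversal `C^{1,α}` surface,
the radially scaled orbits `τ ↦ r • planeRot p e τ θ` cross the frontier exactly once, at an angle
`h r` which has a first-order expansion in `r` at `1`, uniformly in `θ`. The part of such an orbit
before (after) the crossing lies in the interior of `U` if and only if the proposition `Pm` (`Pp`)
holds, independently of `r` and `θ`. -/
lemma exists_crossing {α : ℝ≥0} (hα : 0 < α) (hα1 : α ≤ 1) {U : Set K3}
    (hT : IsC1HolderTransversal α U) {p : K3} (hp : p ∈ frontier U ∩ boundaryH3) :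
    ∃ e : K3, ‖e‖ = 1 ∧ ⟪p, e⟫ = 0 ∧ ∃ T δ L C : ℝ, 0 < T ∧ 0 < δ ∧ δ ≤ 1 ∧ 0 ≤ C ∧
      ∃ Pm Pp : Prop, ∀ θ : K3, ‖θ‖ = 1 → ‖θ - p‖ < δ → ∃ (h : ℝ → ℝ) (D : ℝ), ∀ r, |r - 1| < δ →
        h r ∈ Set.Ioo (-T) T ∧
        (∀ τ ∈ Set.Icc (-T) T, τ ≠ h r → r • planeRot p e τ θ ∉ frontier U) ∧
        (∀ τ ∈ Set.Icc (-T) T, τ < h r → (r • planeRot p e τ θ ∈ interior U ↔ Pm)) ∧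
        (∀ τ ∈ Set.Icc (-T) T, h r < τ → (r • planeRot p e τ θ ∈ interior U ↔ Pp)) ∧
        |h r - h 1| ≤ L * |r - 1| ∧
        |h r - h 1 - D * (r - 1)| ≤ C * |r - 1| ^ (1 + α : ℝ) := by
  obtain ⟨V, hVo, hpV, f, ⟨hfC, H, hfH⟩, hfr, htr⟩ := hT p hp
  have hp1 : ‖p‖ = 1 := by simpa [boundaryH3] using hp.2
  have hfp : f p = 0 := by
    have : p ∈ frontier U ∩ V := ⟨hp.1, hpV⟩
    rw [hfr] at this
    exact this.2
  obtain ⟨e, he, hpe, hfe⟩ := exists_tangent_fderiv_pos (htr p ⟨hpV, hp.2⟩ hfp)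
  have hdiff : ∀ x ∈ V, DifferentiableAt ℝ f x := fun x hx =>
    (hfC.differentiableOn one_ne_zero).differentiableAt (hVo.mem_nhds hx)
  have hfd : ContinuousAt (fderiv ℝ f) p :=
    (hfC.continuousOn_fderiv_of_isOpen hVo le_rfl).continuousAt (hVo.mem_nhds hpV)
  have hnotfr : ∀ x ∈ V, f x ≠ 0 → x ∉ frontier U := by
    intro x hx hfx hxf
    have : x ∈ frontier U ∩ V := ⟨hxf, hx⟩
    rw [hfr] at this
    exact hfx this.2
  -- the derivative of `f` along the rotations
  set Ψ : K3 → ℝ := fun x => fderiv ℝ f x (rotGen p e x) with hΨ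
  have hΨc : ContinuousAt Ψ p := hfd.clm_apply (rotGen p e).continuous.continuousAt
  have hΨp : Ψ p = fderiv ℝ f p e := by
    simp [hΨ, rotGen_apply, hp1, real_inner_comm, hpe]
  set c := Ψ p / 2 with hc
  have hc0 : 0 < c := by rw [hc, hΨp]; linarith
  set M := ‖fderiv ℝ f p‖ + 1 with hM
  have hM0 : 0 ≤ M := by positivity
  obtain ⟨ρ, hρ0, hρ1, hρ⟩ : ∃ ρ : ℝ, 0 < ρ ∧ ρ ≤ 1 ∧ ∀ x ∈ Metric.ball p ρ,
      x ∈ V ∧ c ≤ Ψ x ∧ ‖fderiv ℝ f x‖ ≤ M := by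
    have h1 : ∀ᶠ x in 𝓝 p, x ∈ V ∧ c ≤ Ψ x ∧ ‖fderiv ℝ f x‖ ≤ M := by
      filter_upwards [hVo.mem_nhds hpV, hΨc.eventually_const_lt (show c < Ψ p by linarith),
        hfd.norm.eventually_lt_const (show ‖fderiv ℝ f p‖ < M by linarith)] with x h1 h2 h3
      exact ⟨h1, h2.le, h3.le⟩
    obtain ⟨ρ, hρ0, hρ⟩ := Metric.eventually_nhds_iff_ball.1 h1
    exact ⟨min ρ 1, by positivity, min_le_right _ _, fun x hx =>
      hρ x (Metric.ball_subset_ball (min_le_left _ _) hx)⟩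
  have hR := norm_planeRot hp1 he hpe
  set T := ρ / 8 with hTdef
  have hT0 : 0 < T := by positivity
  -- the orbits stay in the ball
  have hball : ∀ δ ≤ T, ∀ r, |r - 1| < δ → ∀ θ : K3, ‖θ‖ = 1 → ‖θ - p‖ < δ →
      ∀ τ ∈ Set.Icc (-T) T, r • planeRot p e τ θ ∈ Metric.ball p ρ := by
    intro δ hδ r hr θ hθ hθp τ hτ
    rw [mem_ball_iff_norm]
    have e1 : r • planeRot p e τ θ - p = (r - 1) • planeRot p e τ θ + planeRot p e τ (θ - p) +
        (planeRot p e τ p - planeRot p e 0 p) := by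
      rw [map_sub, planeRot_zero]
      module
    have h1 : ‖(r - 1) • planeRot p e τ θ‖ < δ := by
      rwa [norm_smul, hR, hθ, mul_one]
    have h2 : ‖planeRot p e τ (θ - p)‖ < δ := by rwa [hR]
    have h3 := norm_planeRot_sub_le hp1 he hpe p 0 τ
    have h4 : |τ - 0| ≤ T := by
      rw [sub_zero]
      exact abs_le.2 hτ
    rw [hp1] at h3
    rw [e1]
    have := norm_add₃_le (a := (r - 1) • planeRot p e τ θ) (b := planeRot p e τ (θ - p))
      (c := planeRot p e τ p - planeRot p e 0 p)
    linarith
  have hderiv : ∀ (r : ℝ) (θ : K3) (τ : ℝ), r • planeRot p e τ θ ∈ Metric.ball p ρ →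
      HasDerivAt (fun t => f (r • planeRot p e t θ)) (Ψ (r • planeRot p e τ θ)) τ := by
    intro r θ τ hmem
    have h1 := (hdiff _ (hρ _ hmem).1).hasFDerivAt.comp_hasDerivAt τ
      ((hasDerivAt_planeRot hp1 he hpe θ τ).const_smul r)
    exact h1.congr_deriv (by simp [hΨ])
  -- signs at the ends of the orbit through `p`
  have hpball : ∀ τ ∈ Set.Icc (-T) T, planeRot p e τ p ∈ Metric.ball p ρ := by
    intro τ hτ
    simpa using hball T le_rfl 1 (by simpa using hT0) p hp1 (by simpa using hT0) τ hτ
  have hmonop : StrictMonoOn (fun t => f (planeRot p e t p)) (Set.Icc (-T) T) := by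
    have hd : ∀ τ ∈ Set.Icc (-T) T,
        HasDerivAt (fun t => f (planeRot p e t p)) (Ψ (planeRot p e τ p)) τ := fun τ hτ => by
      simpa using hderiv 1 p τ (by simpa using hpball τ hτ)
    refine strictMonoOn_of_deriv_pos (convex_Icc _ _)
      (fun τ hτ => (hd τ hτ).continuousAt.continuousWithinAt) fun τ hτ => ?_
    rw [interior_Icc] at hτ
    have hτ' := Set.Ioo_subset_Icc_self hτ
    rw [(hd τ hτ').deriv]
    exact hc0.trans_le (hρ _ (hpball τ hτ')).2.1
  have hT1 : T ∈ Set.Icc (-T) T := ⟨by linarith, le_rfl⟩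
  have hT2 : -T ∈ Set.Icc (-T) T := ⟨le_rfl, by linarith⟩
  have hT3 : (0 : ℝ) ∈ Set.Icc (-T) T := ⟨by linarith, hT0.le⟩
  have hplus : 0 < f (planeRot p e T p) := by
    have := hmonop hT3 hT1 hT0
    simpa [planeRot_zero, hfp] using this
  have hminus : f (planeRot p e (-T) p) < 0 := by
    have := hmonop hT2 hT3 (by linarith)
    simpa [planeRot_zero, hfp] using this
  obtain ⟨η₁, hη₁, hball₁⟩ : ∃ η > 0, ∀ y ∈ Metric.ball (planeRot p e T p) η, y ∈ V ∧ 0 < f y := by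
    have hV := (hρ _ (hpball T hT1)).1
    exact Metric.eventually_nhds_iff_ball.1 ((hVo.eventually_mem hV).and
      ((hdiff _ hV).continuousAt.eventually_const_lt hplus))
  obtain ⟨η₂, hη₂, hball₂⟩ : ∃ η > 0, ∀ y ∈ Metric.ball (planeRot p e (-T) p) η,
      y ∈ V ∧ f y < 0 := by
    have hV := (hρ _ (hpball (-T) hT2)).1
    exact Metric.eventually_nhds_iff_ball.1 ((hVo.eventually_mem hV).and
      ((hdiff _ hV).continuousAt.eventually_lt_const hminus))
  obtain ⟨δ, hδ0, hδT, hδ₁, hδ₂⟩ : ∃ δ : ℝ, 0 < δ ∧ δ ≤ T ∧ δ ≤ η₁ / 2 ∧ δ ≤ η₂ / 2 :=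
    ⟨min T (min (η₁ / 2) (η₂ / 2)), by positivity, min_le_left _ _,
      (min_le_right _ _).trans (min_le_left _ _), (min_le_right _ _).trans (min_le_right _ _)⟩
  have hend : ∀ r, |r - 1| < δ → ∀ θ : K3, ‖θ‖ = 1 → ‖θ - p‖ < δ → ∀ τ : ℝ,
      ‖r • planeRot p e τ θ - planeRot p e τ p‖ < 2 * δ := by
    intro r hr θ hθ hθp τ
    have e1 : r • planeRot p e τ θ - planeRot p e τ p =
        (r - 1) • planeRot p e τ θ + planeRot p e τ (θ - p) := by
      rw [map_sub]
      module
    rw [e1]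
    refine (norm_add_le _ _).trans_lt ?_
    rw [norm_smul, hR, hR, hθ, Real.norm_eq_abs]
    linarith
  have hδ1 : δ ≤ 1 := by linarith
  have hα0 : (0 : ℝ) < α := hα
  have hα1' : (α : ℝ) ≤ 1 := hα1
  set C₂ : ℝ := (4 * H + 2 * M) * 2 ^ (α : ℝ) with hC₂
  have hC₂0 : 0 ≤ C₂ := by positivity
  have hC0 : 0 ≤ (H : ℝ) / c + M * C₂ * (1 + (M + H) / c) ^ (α : ℝ) / c ^ 2 := by positivity
  refine ⟨e, he, hpe, T, δ, (M + H) / c, _, hT0, hδ0, hδ1, hC0,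
    planeRot p e (-T) p ∈ interior U, planeRot p e T p ∈ interior U, fun θ hθ hθp => ?_⟩
  have hmem : ∀ r, |r - 1| < δ → ∀ τ ∈ Set.Icc (-T) T,
      r • planeRot p e τ θ ∈ Metric.ball p ρ := fun r hr τ hτ =>
    hball δ hδT r hr θ hθ hθp τ hτ
  have h11 : |(1 : ℝ) - 1| < δ := by simpa using hδ0
  have hfHb : HolderOnWith H α (fderiv ℝ f) (Metric.ball p ρ) := hfH.mono fun x hx => (hρ x hx).1
  have hrT : ∀ r, |r - 1| < δ → 0 < f (r • planeRot p e T θ) := fun r hr =>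
    (hball₁ _ (mem_ball_iff_norm.2 ((hend r hr θ hθ hθp T).trans_le (by linarith)))).2
  have hrT' : ∀ r, |r - 1| < δ → f (r • planeRot p e (-T) θ) < 0 := fun r hr =>
    (hball₂ _ (mem_ball_iff_norm.2 ((hend r hr θ hθ hθp (-T)).trans_le (by linarith)))).2
  obtain ⟨h, D, hD⟩ := exists_zero_expansion (g := fun r τ => f (r • planeRot p e τ θ))
    (g' := fun r τ => Ψ (r • planeRot p e τ θ))
    (a := fun τ => fderiv ℝ f (planeRot p e τ θ) (planeRot p e τ θ))
    (α := α) (δ := δ) (T := T) (c := c) (M := M) (C₁ := H) (C₂ := C₂)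
    hα0 hδ0 hδ1 hT0 hc0 hM0 H.2 hC₂0
    (fun r hr τ hτ => hderiv r θ τ (hmem r hr τ hτ))
    (fun r hr τ hτ => (hρ _ (hmem r hr τ hτ)).2.1)
    (fun τ hτ => by
      have h1 := hmem 1 h11 τ hτ
      rw [one_smul] at h1
      have h2 := (fderiv ℝ f (planeRot p e τ θ)).le_of_opNorm_le (hρ _ h1).2.2
        (planeRot p e τ θ)
      rwa [hR, hθ, mul_one] at h2)
    (fun r hr τ hτ => by
      have h1 := hmem 1 h11 τ hτ
      rw [one_smul] at h1
      have h2 := abs_sub_sub_fderiv_le (convex_ball p ρ) (fun x hx => hdiff x (hρ x hx).1) hfHb h1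
        (hmem r hr τ hτ)
      have h3 : r • planeRot p e τ θ - planeRot p e τ θ = (r - 1) • planeRot p e τ θ := by module
      rw [h3, norm_smul, hR, hθ, mul_one, map_smul, smul_eq_mul, mul_comm (r - 1)] at h2
      simpa using h2)
    (fun r hr τ hτ τ' hτ' => by
      set y := r • planeRot p e τ θ with hy
      set x := planeRot p e τ' θ with hx
      have hyb : y ∈ Metric.ball p ρ := hmem r hr τ hτ
      have hxb : x ∈ Metric.ball p ρ := by simpa using hmem 1 h11 τ' hτ'
      set u := |r - 1| + |τ - τ'| with hu
      have hu0 : 0 ≤ u := by positivity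
      have hyx : ‖y - x‖ ≤ 2 * u := by
        have e1 : y - x = (r - 1) • planeRot p e τ θ + (planeRot p e τ θ - planeRot p e τ' θ) := by
          rw [hy, hx]
          module
        rw [e1]
        refine (norm_add_le _ _).trans ?_
        have h2 := norm_planeRot_sub_le hp1 he hpe θ τ' τ
        rw [hθ] at h2
        rw [norm_smul, hR, hθ, Real.norm_eq_abs]
        linarith [abs_nonneg (r - 1)]
      have hu1 : 2 * u ≤ 1 := by
        have h2 : |τ - τ'| ≤ 2 * T := abs_le.2 ⟨by linarith [hτ.1, hτ'.2], by linarith [hτ.2, hτ'.1]⟩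
        linarith
      have hpowu : ‖y - x‖ ^ (α : ℝ) ≤ (2 * u) ^ (α : ℝ) := by gcongr
      have hlin : ‖y - x‖ ≤ (2 * u) ^ (α : ℝ) := by
        refine hyx.trans ?_
        rcases eq_or_ne u 0 with h0 | h0
        · rw [h0, mul_zero]
          exact Real.rpow_nonneg le_rfl _
        · have := Real.rpow_le_rpow_of_exponent_ge (show 0 < 2 * u by positivity) hu1 hα1'
          rwa [Real.rpow_one] at this
      have hy2 : ‖y‖ ≤ 2 := by
        have : y = (r - 1) • planeRot p e τ θ + planeRot p e τ θ := by
          rw [hy]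
          module
        rw [this]
        refine (norm_add_le _ _).trans ?_
        rw [norm_smul, hR, hθ, Real.norm_eq_abs]
        linarith
      have hHol : ‖fderiv ℝ f y - fderiv ℝ f x‖ ≤ H * (2 * u) ^ (α : ℝ) := by
        rw [← dist_eq_norm]
        exact hfHb.dist_le_of_le hyb hxb (by rwa [dist_eq_norm])
      have hid : Ψ y - Ψ x = (fderiv ℝ f y - fderiv ℝ f x) (rotGen p e y) +
          fderiv ℝ f x (rotGen p e (y - x)) := by
        simp [hΨ]
      have hu2 : 0 ≤ (2 * u) ^ (α : ℝ) := by positivity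
      simp only [one_smul]
      rw [hid]
      calc _ ≤ ‖(fderiv ℝ f y - fderiv ℝ f x) (rotGen p e y)‖ +
            ‖fderiv ℝ f x (rotGen p e (y - x))‖ := abs_add_le _ _
        _ ≤ H * (2 * u) ^ (α : ℝ) * (2 * 2) + M * (2 * (2 * u) ^ (α : ℝ)) := by
          gcongr
          · refine ((fderiv ℝ f y - fderiv ℝ f x).le_of_opNorm_le hHol _).trans ?_
            gcongr
            exact (norm_rotGen_le hp1 he y).trans (by linarith)
          · refine ((fderiv ℝ f x).le_of_opNorm_le (hρ _ hxb).2.2 _).trans ?_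
            gcongr
            exact (norm_rotGen_le hp1 he _).trans (by linarith)
        _ = (4 * H + 2 * M) * (2 * u) ^ (α : ℝ) := by ring
        _ = C₂ * u ^ (α : ℝ) := by
          rw [Real.mul_rpow (by norm_num) hu0, hC₂]
          ring)
    hrT' hrT
  refine ⟨h, D, fun r hr => ?_⟩
  obtain ⟨hh, hlt, hgt, hL, hexp⟩ := hD r hr
  have hcont : Continuous fun τ => r • planeRot p e τ θ :=
    ((continuous_planeRot p e).comp (continuous_id.prodMk continuous_const)).const_smul r
  have hV : ∀ τ ∈ Set.Icc (-T) T, r • planeRot p e τ θ ∈ V := fun τ hτ =>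
    (hρ _ (hmem r hr τ hτ)).1
  have hltf : ∀ τ ∈ Set.Icc (-T) T, τ < h r → r • planeRot p e τ θ ∉ frontier U :=
    fun τ hτ hl => hnotfr _ (hV τ hτ) (hlt τ hτ hl).ne
  have hgtf : ∀ τ ∈ Set.Icc (-T) T, h r < τ → r • planeRot p e τ θ ∉ frontier U :=
    fun τ hτ hl => hnotfr _ (hV τ hτ) (hgt τ hτ hl).ne'
  refine ⟨hh, fun τ hτ hne => ?_, fun τ hτ hl => ?_, fun τ hτ hl => ?_, hL, hexp⟩
  · rcases lt_or_gt_of_ne hne with hl | hl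
    exacts [hltf τ hτ hl, hgtf τ hτ hl]
  · have hpre : IsPreconnected ((fun τ => r • planeRot p e τ θ) '' Set.Ico (-T) (h r)) :=
      isPreconnected_Ico.image _ hcont.continuousOn
    have hsub : ∀ t ∈ Set.Ico (-T) (h r), t ∈ Set.Icc (-T) T := fun t ht =>
      ⟨ht.1, (ht.2.trans hh.2).le⟩
    refine (hpre.mem_interior_iff ?_ ⟨τ, ⟨hτ.1, hl⟩, rfl⟩ ⟨-T, ⟨le_rfl, hh.1⟩, rfl⟩).trans ?_
    · rw [Set.disjoint_left]
      rintro _ ⟨t, ht, rfl⟩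
      exact hltf t (hsub t ht) ht.2
    · refine (convex_ball (planeRot p e (-T) p) η₂).isPreconnected.mem_interior_iff ?_
        (mem_ball_iff_norm.2 ((hend r hr θ hθ hθp (-T)).trans_le (by linarith)))
        (Metric.mem_ball_self hη₂)
      rw [Set.disjoint_left]
      exact fun y hy => hnotfr y (hball₂ y hy).1 (hball₂ y hy).2.ne
  · have hpre : IsPreconnected ((fun τ => r • planeRot p e τ θ) '' Set.Ioc (h r) T) :=
      isPreconnected_Ioc.image _ hcont.continuousOn
    have hsub : ∀ t ∈ Set.Ioc (h r) T, t ∈ Set.Icc (-T) T := fun t ht =>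
      ⟨(hh.1.trans ht.1).le, ht.2⟩
    refine (hpre.mem_interior_iff ?_ ⟨τ, ⟨hl, hτ.2⟩, rfl⟩ ⟨T, ⟨hh.2, le_rfl⟩, rfl⟩).trans ?_
    · rw [Set.disjoint_left]
      rintro _ ⟨t, ht, rfl⟩
      exact hgtf t (hsub t ht) ht.1
    · refine (convex_ball (planeRot p e T p) η₁).isPreconnected.mem_interior_iff ?_
        (mem_ball_iff_norm.2 ((hend r hr θ hθ hθp T).trans_le (by linarith)))
        (Metric.mem_ball_self hη₁)
      rw [Set.disjoint_left]
      exact fun y hy => hnotfr y (hball₁ y hy).1 (hball₁ y hy).2.ne'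

end LocalGeometry

/-! ### Spherical slices of a transversal set -/

/-- The surface measure of the unit sphere of `𝕂³`. -/
noncomputable abbrev sphereMeasure : Measure (Metric.sphere (0 : K3) 1) :=
  (volume : Measure K3).toSphere

lemma measurable_mul_indicator_smul {w : K3 → ℝ} (hw : Continuous w) {S : Set K3}
    (hS : MeasurableSet S) (r : ℝ) :
    Measurable fun x : K3 => w x * S.indicator (1 : K3 → ℝ) (r • x) :=
  hw.measurable.mul ((measurable_one.indicator hS).comp (measurable_const_smul r))

lemma abs_mul_indicator_le {w : K3 → ℝ} (hw0 : ∀ x, 0 ≤ w x) (hw1 : ∀ x, w x ≤ 1) (S : Set K3)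
    (x y : K3) : |w x * S.indicator (1 : K3 → ℝ) y| ≤ 1 := by
  rw [abs_mul, abs_of_nonneg (hw0 x)]
  have : |S.indicator (1 : K3 → ℝ) y| ≤ 1 := by
    by_cases h : y ∈ S <;> simp [h]
  nlinarith [hw0 x, hw1 x, abs_nonneg (S.indicator (1 : K3 → ℝ) y)]

lemma integral_tent_pos {T s : ℝ} (hs : 0 < s) (hsT : s ≤ T) :
    0 < ∫ τ in Set.Ioc (-T) T, max 0 (s - |τ|) := by
  have hc : Continuous fun τ : ℝ => max 0 (s - |τ|) := by fun_prop
  rw [← intervalIntegral.integral_of_le (by linarith)]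
  refine intervalIntegral.integral_pos (by linarith) hc.continuousOn
    (fun _ _ => le_max_left _ _) ⟨0, ⟨by linarith, by linarith⟩, ?_⟩
  simpa using hs

/-- Near a point of the frontier, the weighted area of the spherical slices of radius `r` has a
first-order expansion at `r = 1`, and the slices of the frontier are null sets. -/
lemma expandsAtOne_slice_of_mem_frontier {α : ℝ≥0} (hα : 0 < α) (hα1 : α ≤ 1) {U : Set K3}
    (hT : IsC1HolderTransversal α U) {p : K3} (hp : p ∈ frontier U ∩ boundaryH3) :
    ∃ ρ > 0, ∀ (w : K3 → ℝ) (K : ℝ≥0), LipschitzWith K w → (∀ x, 0 ≤ w x) → (∀ x, w x ≤ 1) →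
      (∀ x, w x ≠ 0 → x ∈ Metric.ball p ρ) →
      ExpandsAtOne α (fun r => ∫ θ, w (θ : K3) *
        (interior U).indicator (1 : K3 → ℝ) (r • (θ : K3)) ∂sphereMeasure) ∧
      ∀ᶠ r : ℝ in 𝓝 1, ∫ θ, w (θ : K3) *
        (frontier U).indicator (1 : K3 → ℝ) (r • (θ : K3)) ∂sphereMeasure = 0 := by
  obtain ⟨e, he, hpe, T, δ, L, C, hT0, hδ0, hδ1, hC0, Pm, Pp, hcross⟩ :=
    exists_crossing hα hα1 hT hp
  have hp1 : ‖p‖ = 1 := by simpa [boundaryH3] using hp.2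
  refine ⟨δ / 2, by positivity, fun w K hw hw0 hw1 hsupp => ?_⟩
  -- a weight on the angles which keeps the orbits meeting the support of `w` close to `p`
  set s := min T (δ / 4) with hs
  have hs0 : 0 < s := by positivity
  have hsδ : s ≤ δ / 4 := min_le_right _ _
  set k : ℝ → ℝ := fun τ => max 0 (s - |τ|) with hk
  have hkc : Continuous k := by fun_prop
  have hk0 : ∀ τ, 0 ≤ k τ := fun τ => le_max_left _ _
  have hk1 : ∀ τ, k τ ≤ 1 := fun τ => max_le zero_le_one (by linarith [abs_nonneg τ])
  have hkL : ∀ τ τ', |k τ - k τ'| ≤ |τ - τ'| := fun τ τ' => by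
    refine (abs_max_sub_max_le_max 0 (s - |τ|) 0 (s - |τ'|)).trans ?_
    rw [sub_self, abs_zero, sub_sub_sub_cancel_left]
    refine max_le (abs_nonneg _) ?_
    rw [abs_sub_comm τ τ']
    exact abs_abs_sub_abs_le _ _
  have hkpos : 0 < ∫ τ in Set.Ioc (-T) T, k τ := integral_tent_pos hs0 (min_le_left _ _)
  have hfar : ∀ θ : K3, ‖θ‖ = 1 → ¬ ‖θ - p‖ < δ → ∀ τ, k τ * w (planeRot p e τ θ) = 0 := by
    intro θ hθ hfar τ
    by_contra hne
    have hkne : k τ ≠ 0 := left_ne_zero_of_mul hne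
    have hτ : |τ| < s := by
      by_contra hcon
      exact hkne (max_eq_left (by linarith))
    have h1 := hsupp _ (right_ne_zero_of_mul hne)
    rw [mem_ball_iff_norm] at h1
    have h2 := norm_planeRot_sub_le hp1 he hpe θ τ 0
    rw [hθ, planeRot_zero, zero_sub, abs_neg] at h2
    have h3 := norm_sub_le_norm_sub_add_norm_sub θ (planeRot p e τ θ) p
    linarith
  have hqL : ∀ θ : K3, ‖θ‖ = 1 →
      LipschitzWith (1 + K * 2) fun τ => k τ * w (planeRot p e τ θ) := by
    intro θ hθ
    refine LipschitzWith.of_dist_le_mul fun τ τ' => ?_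
    have h1 : |w (planeRot p e τ θ) - w (planeRot p e τ' θ)| ≤ K * (2 * |τ - τ'|) := by
      rw [← Real.dist_eq]
      refine (hw.dist_le_mul _ _).trans ?_
      have := norm_planeRot_sub_le hp1 he hpe θ τ' τ
      rw [hθ] at this
      rw [dist_eq_norm]
      gcongr
      linarith
    rw [Real.dist_eq, Real.dist_eq]
    have hid : k τ * w (planeRot p e τ θ) - k τ' * w (planeRot p e τ' θ) =
        (k τ - k τ') * w (planeRot p e τ θ) +
          k τ' * (w (planeRot p e τ θ) - w (planeRot p e τ' θ)) := by ring
    rw [hid]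
    calc _ ≤ |(k τ - k τ') * w (planeRot p e τ θ)| +
          |k τ' * (w (planeRot p e τ θ) - w (planeRot p e τ' θ))| := abs_add_le _ _
      _ ≤ |τ - τ'| * 1 + 1 * (K * (2 * |τ - τ'|)) := by
        rw [abs_mul, abs_mul, abs_of_nonneg (hw0 _), abs_of_nonneg (hk0 _)]
        exact add_le_add (mul_le_mul (hkL _ _) (hw1 _) (hw0 _) (abs_nonneg _))
          (mul_le_mul (hk1 _) h1 (abs_nonneg _) zero_le_one)
      _ = _ := by
        push_cast
        ring
  have hqQ : ∀ θ : K3, ∀ τ, |k τ * w (planeRot p e τ θ)| ≤ 1 := fun θ τ => by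
    rw [abs_of_nonneg (mul_nonneg (hk0 _) (hw0 _))]
    exact mul_le_one₀ (hk1 _) (hw0 _) (hw1 _)
  have havg : ∀ {S : Set K3}, MeasurableSet S → ∀ r : ℝ,
      ∫ θ, w (θ : K3) * S.indicator (1 : K3 → ℝ) (r • (θ : K3)) ∂sphereMeasure =
        (∫ τ in Set.Ioc (-T) T, k τ)⁻¹ * ∫ θ, (∫ τ in Set.Ioc (-T) T,
          k τ * (w (planeRot p e τ (θ : K3)) *
            S.indicator (1 : K3 → ℝ) (r • planeRot p e τ (θ : K3)))) ∂sphereMeasure := by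
    intro S hS r
    rw [← integral_sphere_eq_average hp1 he hpe hkc (measurable_mul_indicator_smul hw.continuous hS r)
      (fun x => abs_mul_indicator_le hw0 hw1 S x _) T, inv_mul_cancel_left₀ hkpos.ne']
  have hnorm : ∀ θ : Metric.sphere (0 : K3) 1, ‖(θ : K3)‖ = 1 := fun θ => by simp
  constructor
  · have hI : MeasurableSet (interior U) := isOpen_interior.measurableSet
    simp only [havg hI]
    refine ExpandsAtOne.const_mul ?_ _
    refine expandsAtOne_integral (C := ((1 + K * 2 : ℝ≥0) : ℝ) * L ^ 2 + 1 * C) (NNReal.coe_pos.2 hα)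
      hδ0 (fun r _ => ?_) (fun θ => ?_)
    · exact (integrable_average p e hkc (measurable_mul_indicator_smul hw.continuous hI r)
        (fun x => abs_mul_indicator_le hw0 hw1 _ x _) T).integral_prod_left
    · simp only [← mul_assoc]
      by_cases hθ : ‖(θ : K3) - p‖ < δ
      · classical
        obtain ⟨h, D, hD⟩ := hcross θ (hnorm θ) hθ
        refine ⟨((if Pm then 1 else 0) - (if Pp then 1 else 0)) *
          (k (h 1) * w (planeRot p e (h 1) θ)) * D, fun r hr => ?_⟩
        refine step_integral_expansion (hqL θ (hnorm θ)) (hqQ θ) hα1 hδ0 hδ1 ?_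
          (χ := fun r τ => (interior U).indicator (1 : K3 → ℝ) (r • planeRot p e τ (θ : K3)))
          (fun r hr => (hD r hr).1) (fun r hr τ hτ hlt => ?_) (fun r hr τ hτ hgt => ?_)
          (fun r hr => (hD r hr).2.2.2.2.1) (fun r hr => (hD r hr).2.2.2.2.2) hr
        · split_ifs <;> norm_num
        · simp only [Set.indicator_apply, (hD r hr).2.2.1 τ hτ hlt, Pi.one_apply]
        · simp only [Set.indicator_apply, (hD r hr).2.2.2.1 τ hτ hgt, Pi.one_apply]
      · refine ⟨0, fun r _ => ?_⟩
        simp only [hfar θ (hnorm θ) hθ, zero_mul, integral_zero, sub_zero, abs_zero]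
        positivity
  · filter_upwards [Metric.ball_mem_nhds (1 : ℝ) hδ0] with r hr
    rw [Metric.mem_ball, Real.dist_eq] at hr
    rw [havg isClosed_frontier.measurableSet]
    refine mul_eq_zero_of_right _ ?_
    refine integral_eq_zero_of_ae (Eventually.of_forall fun θ => ?_)
    refine integral_eq_zero_of_ae ?_
    by_cases hθ : ‖(θ : K3) - p‖ < δ
    · obtain ⟨h, D, hD⟩ := hcross θ (hnorm θ) hθ
      have hne : ∀ᵐ τ ∂(volume.restrict (Set.Ioc (-T) T)), τ ≠ h r :=
        ae_restrict_of_ae (Measure.ae_ne volume (h r))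
      filter_upwards [hne, ae_restrict_mem measurableSet_Ioc] with τ hτ hmem
      have := (hD r hr).2.1 τ (Set.Ioc_subset_Icc_self hmem) hτ
      simp [this]
    · refine Eventually.of_forall fun τ => ?_
      simp only [← mul_assoc, hfar θ (hnorm θ) hθ, zero_mul, Pi.zero_apply]

lemma expandsAtOne_slice_of_notMem_frontier (α : ℝ≥0) {U : Set K3} {p : K3}
    (hp : p ∉ frontier U) :
    ∃ ρ > 0, ∀ w : K3 → ℝ, (∀ x, w x ≠ 0 → x ∈ Metric.ball p ρ) →
      ExpandsAtOne α (fun r => ∫ θ, w (θ : K3) *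
        (interior U).indicator (1 : K3 → ℝ) (r • (θ : K3)) ∂sphereMeasure) ∧
      ∀ᶠ r : ℝ in 𝓝 1, ∫ θ, w (θ : K3) *
        (frontier U).indicator (1 : K3 → ℝ) (r • (θ : K3)) ∂sphereMeasure = 0 := by
  obtain ⟨ρ, hρ, hball⟩ := Metric.isOpen_iff.1 isClosed_frontier.isOpen_compl p hp
  have hmem : ∀ r : ℝ, |r - 1| < ρ / 2 → ∀ θ : Metric.sphere (0 : K3) 1,
      (θ : K3) ∈ Metric.ball p (ρ / 2) → r • (θ : K3) ∈ Metric.ball p ρ := by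
    intro r hr θ hθ
    rw [mem_ball_iff_norm] at hθ ⊢
    have e1 : r • (θ : K3) - p = (r - 1) • (θ : K3) + ((θ : K3) - p) := by module
    rw [e1]
    refine (norm_add_le _ _).trans_lt ?_
    rw [norm_smul, norm_eq_of_mem_sphere, Real.norm_eq_abs]
    linarith
  have hnhds : ∀ᶠ r : ℝ in 𝓝 1, |r - 1| < ρ / 2 := by
    filter_upwards [Metric.ball_mem_nhds (1 : ℝ) (half_pos hρ)] with r hr
    rwa [Metric.mem_ball, Real.dist_eq] at hr
  refine ⟨ρ / 2, half_pos hρ, fun w hsupp => ⟨?_, ?_⟩⟩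
  · refine (expandsAtOne_const α (∫ θ, w (θ : K3) *
      (interior U).indicator (1 : K3 → ℝ) p ∂sphereMeasure)).congr ?_
    filter_upwards [hnhds] with r hr
    congr 1
    ext θ
    by_cases hw : w θ = 0
    · simp [hw]
    · have h1 := (convex_ball p ρ).isPreconnected.mem_interior_iff
        (Set.disjoint_left.2 fun y hy => hball hy) (Metric.mem_ball_self hρ)
        (hmem r hr θ (hsupp _ hw))
      classical
      simp only [Set.indicator_apply, h1, Pi.one_apply]
  · filter_upwards [hnhds] with r hr
    refine integral_eq_zero_of_ae (Eventually.of_forall fun θ => ?_)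
    by_cases hw : w θ = 0
    · simp [hw]
    · have := hball (hmem r hr θ (hsupp _ hw))
      rw [Set.mem_compl_iff] at this
      simp [this]

lemma exists_lipschitz_partition {s : Set K3} (hs : IsCompact s) {ρ : K3 → ℝ}
    (hρ : ∀ p ∈ s, 0 < ρ p) :
    ∃ (t : Finset K3) (w : K3 → K3 → ℝ), (∀ p ∈ t, p ∈ s) ∧
      (∀ p ∈ t, (∃ K, LipschitzWith K (w p)) ∧ (∀ x, 0 ≤ w p x) ∧ (∀ x, w p x ≤ 1) ∧
        ∀ x, w p x ≠ 0 → x ∈ Metric.ball p (ρ p)) ∧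
      ∀ x ∈ s, ∑ p ∈ t, w p x = 1 := by
  obtain ⟨t, hts, hcover⟩ := hs.elim_nhds_subcover (fun p => Metric.ball p (ρ p))
    fun p hp => Metric.ball_mem_nhds p (hρ p hp)
  obtain ⟨f, hf⟩ := SmoothPartitionOfUnity.exists_isSubordinate (modelWithCornersSelf ℝ K3)
    (M := K3) hs.isClosed (fun p : t => Metric.ball (p : K3) (ρ p)) (fun p => Metric.isOpen_ball)
    (by simpa [Set.iUnion_subtype] using hcover)
  classical
  refine ⟨t, fun p x => if h : p ∈ t then f ⟨p, h⟩ x else 0, hts, fun p hp => ?_, fun x hx => ?_⟩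
  · simp only [hp, dif_pos]
    refine ⟨?_, fun x => f.nonneg _ x, fun x => f.le_one _ x, fun x hx => ?_⟩
    · have hcs : HasCompactSupport (f ⟨p, hp⟩) :=
        (isCompact_closedBall p (ρ p)).of_isClosed_subset (isClosed_tsupport _)
          ((hf ⟨p, hp⟩).trans Metric.ball_subset_closedBall)
      exact ((f ⟨p, hp⟩).contMDiff.contDiff).lipschitzWith_of_hasCompactSupport hcs (by simp)
    · exact hf ⟨p, hp⟩ (subset_tsupport _ hx)
  · rw [← Finset.sum_coe_sort t]
    have := f.sum_eq_one hx
    rw [finsum_eq_sum_of_fintype] at this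
    simpa using this

/-- The area of the spherical slices of radius `r` of the interior of `U` has a first-order
expansion at `r = 1`, and the slices of the frontier have area zero. -/
lemma expandsAtOne_slice {α : ℝ≥0} (hα : 0 < α) (hα1 : α ≤ 1) {U : Set K3}
    (hT : IsC1HolderTransversal α U) :
    ExpandsAtOne α (fun r => ∫ θ,
      (interior U).indicator (1 : K3 → ℝ) (r • (θ : K3)) ∂sphereMeasure) ∧
    ∀ᶠ r : ℝ in 𝓝 1, ∫ θ,
      (frontier U).indicator (1 : K3 → ℝ) (r • (θ : K3)) ∂sphereMeasure = 0 := by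
  have hloc : ∀ p : K3, ∃ ρ : ℝ, p ∈ Metric.sphere (0 : K3) 1 → 0 < ρ ∧
      ∀ (w : K3 → ℝ) (K : ℝ≥0), LipschitzWith K w → (∀ x, 0 ≤ w x) → (∀ x, w x ≤ 1) →
      (∀ x, w x ≠ 0 → x ∈ Metric.ball p ρ) →
      ExpandsAtOne α (fun r => ∫ θ, w (θ : K3) *
        (interior U).indicator (1 : K3 → ℝ) (r • (θ : K3)) ∂sphereMeasure) ∧
      ∀ᶠ r : ℝ in 𝓝 1, ∫ θ, w (θ : K3) *
        (frontier U).indicator (1 : K3 → ℝ) (r • (θ : K3)) ∂sphereMeasure = 0 := by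
    intro p
    by_cases hp : p ∈ Metric.sphere (0 : K3) 1
    · by_cases hpf : p ∈ frontier U
      · obtain ⟨ρ, h1, h2⟩ := expandsAtOne_slice_of_mem_frontier hα hα1 hT ⟨hpf, hp⟩
        exact ⟨ρ, fun _ => ⟨h1, h2⟩⟩
      · obtain ⟨ρ, h1, h2⟩ := expandsAtOne_slice_of_notMem_frontier α hpf
        exact ⟨ρ, fun _ => ⟨h1, fun w _ _ _ _ => h2 w⟩⟩
    · exact ⟨0, fun h => absurd h hp⟩
  choose ρ hρ using hloc
  obtain ⟨t, w, hts, hw, hsum⟩ := exists_lipschitz_partition (isCompact_sphere (0 : K3) 1)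
    fun p hp => (hρ p hp).1
  have hres := fun p (hp : p ∈ t) => (hρ p (hts p hp)).2 (w p) (hw p hp).1.choose
    (hw p hp).1.choose_spec (hw p hp).2.1 (hw p hp).2.2.1 (hw p hp).2.2.2
  have hsplit : ∀ {S : Set K3}, MeasurableSet S → ∀ r : ℝ,
      ∫ θ, S.indicator (1 : K3 → ℝ) (r • (θ : K3)) ∂sphereMeasure =
        ∑ p ∈ t, ∫ θ, w p (θ : K3) * S.indicator (1 : K3 → ℝ) (r • (θ : K3)) ∂sphereMeasure := by
    intro S hS r
    rw [← integral_finsetSum]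
    · congr 1
      ext θ
      rw [← Finset.sum_mul, hsum θ θ.2, one_mul]
    · intro p hp
      obtain ⟨⟨K, hK⟩, h0, h1, -⟩ := hw p hp
      refine Integrable.of_bound ((measurable_mul_indicator_smul hK.continuous hS r).comp
        measurable_subtype_coe).aestronglyMeasurable 1 (Eventually.of_forall fun θ => ?_)
      exact abs_mul_indicator_le h0 h1 S _ _
  constructor
  · simp only [hsplit isOpen_interior.measurableSet]
    exact ExpandsAtOne.sum t fun p hp => (hres p hp).1
  · have : ∀ᶠ r : ℝ in 𝓝 1, ∀ p ∈ t, ∫ θ, w p (θ : K3) *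
        (frontier U).indicator (1 : K3 → ℝ) (r • (θ : K3)) ∂sphereMeasure = 0 :=
      (Finset.eventually_all t).2 fun p hp => (hres p hp).2
    filter_upwards [this] with r hr
    rw [hsplit isClosed_frontier.measurableSet]
    exact Finset.sum_eq_zero hr

/-! ### The radial density -/

/-- The density of `dV_ε` as a function of the radius. -/
noncomputable def radialDensity (ε r : ℝ) : ℂ :=
  dEps ε / ((dEps ε) ^ 2 - (r : ℂ) ^ 2) ^ 2

lemma volDensity_eq (ε : ℝ) (x : K3) : volDensity ε x = radialDensity ε ‖x‖ := rfl

lemma dEps_sq_sub_eq (ε r : ℝ) :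
    (dEps ε) ^ 2 - (r : ℂ) ^ 2 = ⟨1 - ε ^ 2 - r ^ 2, -(2 * ε)⟩ := by
  apply Complex.ext <;> simp [dEps, sq]
  ring

lemma abs_one_sub_sq_le_norm (ε r : ℝ) : |1 - r ^ 2| ≤ ‖(dEps ε) ^ 2 - (r : ℂ) ^ 2‖ := by
  refine abs_le_of_sq_le_sq ?_ (norm_nonneg _)
  rw [← Complex.normSq_eq_norm_sq, dEps_sq_sub_eq, Complex.normSq_mk]
  nlinarith [sq_nonneg ε, sq_nonneg (ε * r), sq_nonneg (ε ^ 2)]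

lemma two_mul_le_norm (ε r : ℝ) : 2 * ε ≤ ‖(dEps ε) ^ 2 - (r : ℂ) ^ 2‖ := by
  refine le_trans ?_ (Complex.abs_im_le_norm _)
  rw [dEps_sq_sub_eq, abs_neg]
  exact le_abs_self _

lemma dEps_sq_sub_ne_zero {ε : ℝ} (hε : 0 < ε) (r : ℝ) : (dEps ε) ^ 2 - (r : ℂ) ^ 2 ≠ 0 := by
  have := two_mul_le_norm ε r
  exact norm_pos_iff.1 (by linarith)

lemma norm_dEps_le {ε : ℝ} (hε : 0 < ε) : ‖dEps ε‖ ≤ 1 + ε := by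
  refine (norm_sub_le _ _).trans ?_
  simp [abs_of_pos hε]

lemma continuous_dEps : Continuous dEps := by
  unfold dEps
  fun_prop

lemma dEps_zero : dEps 0 = 1 := by simp [dEps]

lemma continuous_radialDensity {ε : ℝ} (hε : 0 < ε) : Continuous (radialDensity ε) := by
  unfold radialDensity
  exact continuous_const.div (by fun_prop) fun r => pow_ne_zero _ (dEps_sq_sub_ne_zero hε r)

lemma norm_radialDensity_le {ε r η : ℝ} (hε : 0 < ε) (hη : 0 < η)
    (h : η ≤ ‖(dEps ε) ^ 2 - (r : ℂ) ^ 2‖) : ‖radialDensity ε r‖ ≤ (1 + ε) / η ^ 2 := by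
  rw [radialDensity, norm_div, norm_pow]
  gcongr
  exact norm_dEps_le hε

lemma tendsto_radialDensity {r : ℝ} (hr : 1 - r ^ 2 ≠ 0) :
    Tendsto (fun ε => radialDensity ε r) (𝓝[>] 0) (𝓝 (radialDensity 0 r)) := by
  have : ContinuousAt (fun ε => radialDensity ε r) 0 := by
    unfold radialDensity
    refine continuous_dEps.continuousAt.div (by have := continuous_dEps; fun_prop) ?_
    rw [dEps_zero, one_pow]
    exact_mod_cast pow_ne_zero 2 hr
  exact this.tendsto.mono_left nhdsWithin_le_nhds

lemma hasDerivAt_dEps_sq_sub (ε r : ℝ) :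
    HasDerivAt (fun t : ℝ => (dEps ε) ^ 2 - (t : ℂ) ^ 2) (-(2 * (r : ℂ))) r := by
  have h := ((Complex.ofRealCLM.hasDerivAt (x := r)).pow 2).const_sub ((dEps ε) ^ 2)
  simpa using h

lemma integral_mul_radialDensity {ε : ℝ} (hε : 0 < ε) (x y : ℝ) :
    ∫ r in x..y, (r : ℂ) * radialDensity ε r =
      dEps ε * (1 / (2 * ((dEps ε) ^ 2 - (y : ℂ) ^ 2)) -
        1 / (2 * ((dEps ε) ^ 2 - (x : ℂ) ^ 2))) := by
  rw [mul_sub]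
  refine intervalIntegral.integral_eq_sub_of_hasDerivAt
    (f := fun t : ℝ => dEps ε * (1 / (2 * ((dEps ε) ^ 2 - (t : ℂ) ^ 2)))) (fun r _ => ?_)
    ((Complex.continuous_ofReal.mul (continuous_radialDensity hε)).intervalIntegrable _ _)
  have hne := dEps_sq_sub_ne_zero hε r
  have h := ((((hasDerivAt_dEps_sq_sub ε r).const_mul 2).fun_inv
    (mul_ne_zero two_ne_zero hne)).const_mul (dEps ε))
  simp only [one_div]
  refine h.congr_deriv ?_
  rw [radialDensity]
  field_simp

/-- The logarithm is that of `i (d_ε² - r²)`, which has positive real part `2 ε`, so that it stays in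
the domain of the principal branch, also in the limit `ε → 0`. -/
lemma integral_mul_sq_sub_one_mul_radialDensity {ε : ℝ} (hε : 0 < ε) (x y : ℝ) :
    ∫ r in x..y, ((r * (r ^ 2 - 1) : ℝ) : ℂ) * radialDensity ε r =
      dEps ε * (Complex.log (Complex.I * ((dEps ε) ^ 2 - (y : ℂ) ^ 2)) / 2 +
        ((dEps ε) ^ 2 - 1) * (1 / (2 * ((dEps ε) ^ 2 - (y : ℂ) ^ 2)))) -
      dEps ε * (Complex.log (Complex.I * ((dEps ε) ^ 2 - (x : ℂ) ^ 2)) / 2 +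
        ((dEps ε) ^ 2 - 1) * (1 / (2 * ((dEps ε) ^ 2 - (x : ℂ) ^ 2)))) := by
  refine intervalIntegral.integral_eq_sub_of_hasDerivAt
    (f := fun t : ℝ => dEps ε * (Complex.log (Complex.I * ((dEps ε) ^ 2 - (t : ℂ) ^ 2)) / 2 +
        ((dEps ε) ^ 2 - 1) * (1 / (2 * ((dEps ε) ^ 2 - (t : ℂ) ^ 2))))) (fun r _ => ?_)
    (((Complex.continuous_ofReal.comp (by fun_prop)).mul
      (continuous_radialDensity hε)).intervalIntegrable _ _)
  have hne := dEps_sq_sub_ne_zero hε r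
  have hslit : Complex.I * ((dEps ε) ^ 2 - (r : ℂ) ^ 2) ∈ Complex.slitPlane := by
    left
    rw [dEps_sq_sub_eq]
    simpa using hε
  have h0 := hasDerivAt_dEps_sq_sub ε r
  have h := ((((h0.const_mul Complex.I).clog_real hslit).div_const 2).add
    (((h0.const_mul 2).fun_inv (mul_ne_zero two_ne_zero hne)).const_mul
      ((dEps ε) ^ 2 - 1))).const_mul (dEps ε)
  simp only [one_div]
  refine h.congr_deriv ?_
  rw [radialDensity]
  have hI := Complex.I_ne_zero
  push_cast
  field_simp
  ring

/-- Both primitives are continuous in `ε` at `0` as long as the end points stay off the unit sphere. -/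
lemma exists_tendsto_integral_mul_radialDensity {x y : ℝ} (hx : 1 - x ^ 2 ≠ 0)
    (hy : 1 - y ^ 2 ≠ 0) :
    (∃ m, Tendsto (fun ε => ∫ r in x..y, (r : ℂ) * radialDensity ε r) (𝓝[>] 0) (𝓝 m)) ∧
    ∃ m, Tendsto (fun ε => ∫ r in x..y, ((r * (r ^ 2 - 1) : ℝ) : ℂ) * radialDensity ε r)
      (𝓝[>] 0) (𝓝 m) := by
  have hc := continuous_dEps.continuousAt (x := 0)
  have hz : ∀ {t : ℝ}, 1 - t ^ 2 ≠ 0 → (dEps 0) ^ 2 - (t : ℂ) ^ 2 ≠ 0 := by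
    intro t ht
    rw [dEps_zero, one_pow]
    exact_mod_cast ht
  have hinv : ∀ {t : ℝ}, 1 - t ^ 2 ≠ 0 →
      ContinuousAt (fun ε => 1 / (2 * ((dEps ε) ^ 2 - (t : ℂ) ^ 2))) 0 := fun ht =>
    continuousAt_const.div (continuousAt_const.mul ((hc.pow 2).sub continuousAt_const))
      (mul_ne_zero two_ne_zero (hz ht))
  have hlog : ∀ {t : ℝ}, 1 - t ^ 2 ≠ 0 → ContinuousAt
      (fun ε => dEps ε * (Complex.log (Complex.I * ((dEps ε) ^ 2 - (t : ℂ) ^ 2)) / 2 +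
        ((dEps ε) ^ 2 - 1) * (1 / (2 * ((dEps ε) ^ 2 - (t : ℂ) ^ 2))))) 0 := by
    intro t ht
    refine hc.mul (((ContinuousAt.clog (continuousAt_const.mul
      ((hc.pow 2).sub continuousAt_const)) ?_).div_const 2).add
      (((hc.pow 2).sub continuousAt_const).mul (hinv ht)))
    right
    change (Complex.I * ((dEps 0) ^ 2 - (t : ℂ) ^ 2)).im ≠ 0
    rw [dEps_sq_sub_eq]
    simpa using ht
  constructor
  · refine ⟨_, Tendsto.congr' ?_ ((hc.mul ((hinv hy).sub (hinv hx))).tendsto.mono_left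
      nhdsWithin_le_nhds)⟩
    filter_upwards [self_mem_nhdsWithin] with ε hε
    exact (integral_mul_radialDensity hε x y).symm
  · refine ⟨_, Tendsto.congr' ?_ (((hlog hy).sub (hlog hx)).tendsto.mono_left
      nhdsWithin_le_nhds)⟩
    filter_upwards [self_mem_nhdsWithin] with ε hε
    exact (integral_mul_sq_sub_one_mul_radialDensity hε x y).symm

lemma integrableOn_abs_sub_rpow {β δ : ℝ} (hβ : 0 < β) (hδ : 0 < δ) :
    IntegrableOn (fun r => |r - 1| ^ (β - 1)) (Set.Ioo (1 - δ) (1 + δ)) := by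
  have h1 : IntervalIntegrable (fun r : ℝ => |r| ^ (β - 1)) volume 0 δ := by
    refine (intervalIntegral.intervalIntegrable_rpow' (r := β - 1) (by linarith)).congr ?_
    intro r hr
    rw [Set.uIoc_of_le hδ.le] at hr
    simp only
    rw [abs_of_pos hr.1]
  have h2 : IntervalIntegrable (fun r : ℝ => |r| ^ (β - 1)) volume (-δ) δ := by
    refine IntervalIntegrable.trans (b := 0) ?_ h1
    have := (IntervalIntegrable.iff_comp_neg (f := fun r : ℝ => |r| ^ (β - 1)) (a := 0)
      (b := δ)).1 h1
    simpa using this.symm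
  have h3 := h2.comp_sub_right 1
  rw [neg_add_eq_sub, add_comm δ 1] at h3
  exact ((intervalIntegrable_iff_integrableOn_Ioo_of_le (by linarith)).1 h3)

/-- A function with a first-order expansion at `r = 1` can be integrated against `r ^ 2` times the
radial density near `r = 1`, with a limit as `ε → 0`. -/
lemma ExpandsAtOne.exists_tendsto {β : ℝ} (hβ : 0 < β) (hβ1 : β ≤ 1) {A : ℝ → ℝ}
    (hA : ExpandsAtOne β A) (hmeas : Measurable A) :
    ∃ δ₀ > 0, ∀ δ, 0 < δ → δ ≤ δ₀ → ∃ m : ℂ, Tendsto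
      (fun ε => ∫ r in Set.Ioo (1 - δ) (1 + δ), ((r ^ 2 * A r : ℝ) : ℂ) * radialDensity ε r)
      (𝓝[>] 0) (𝓝 m) := by
  obtain ⟨a, b, hab⟩ := hA
  obtain ⟨C, hC0, hC⟩ := hab.exists_nonneg
  obtain ⟨δ₁, hδ₁, hball⟩ := Metric.eventually_nhds_iff_ball.1 hC.bound
  refine ⟨min δ₁ (1 / 2), by positivity, fun δ hδ hδle => ?_⟩
  have hδ2 : δ ≤ 1 / 2 := hδle.trans (min_le_right _ _)
  have hδ1 : δ ≤ δ₁ := hδle.trans (min_le_left _ _)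
  -- the remainder after subtracting multiples of `r` and `r (r² - 1)`, which integrate explicitly
  set b' := (a + b) / 2 with hb'
  set R : ℝ → ℝ := fun r => r ^ 2 * A r - a * r - b' * (r * (r ^ 2 - 1)) with hR
  have hRmeas : Measurable R := by
    rw [hR]
    fun_prop
  have hRbound : ∀ r ∈ Set.Ioo (1 - δ) (1 + δ),
      |R r| ≤ (4 * C + 2 * |b - b'|) * |r - 1| ^ (1 + β) := by
    intro r hr
    have hs : |r - 1| < δ := abs_lt.2 ⟨by linarith [hr.1], by linarith [hr.2]⟩
    have hr0 : 0 < r := by linarith [hr.1]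
    have hr2 : r ≤ 2 := by linarith [hr.2]
    have h1 := hball r (by rw [Metric.mem_ball, Real.dist_eq]; linarith)
    rw [Real.norm_eq_abs, Real.norm_eq_abs,
      abs_of_nonneg (Real.rpow_nonneg (abs_nonneg (r - 1)) _)] at h1
    have hsq : (r - 1) ^ 2 ≤ |r - 1| ^ (1 + β) := by
      rw [← sq_abs]
      rcases eq_or_ne (r - 1) 0 with h0 | h0
      · rw [h0, abs_zero, Real.zero_rpow (by linarith)]
        norm_num
      · rw [← Real.rpow_natCast]
        exact Real.rpow_le_rpow_of_exponent_ge (abs_pos.2 h0) (by linarith) (by push_cast; linarith)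
    have hid : R r = r ^ 2 * (A r - a - b * (r - 1)) + r * ((b - b') * (r - 1) ^ 2) := by
      rw [hR, hb']
      ring
    rw [hid]
    calc _ ≤ |r ^ 2 * (A r - a - b * (r - 1))| + |r * ((b - b') * (r - 1) ^ 2)| := abs_add_le _ _
      _ = r ^ 2 * |A r - a - b * (r - 1)| + r * (|b - b'| * (r - 1) ^ 2) := by
        rw [abs_mul, abs_mul, abs_mul, abs_of_pos hr0, abs_of_nonneg (sq_nonneg r),
          abs_of_nonneg (sq_nonneg (r - 1))]
      _ ≤ 2 ^ 2 * (C * |r - 1| ^ (1 + β)) + 2 * (|b - b'| * |r - 1| ^ (1 + β)) := by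
        gcongr
      _ = _ := by ring
  have hx : 1 - (1 - δ) ^ 2 ≠ 0 := by nlinarith
  have hy : 1 - (1 + δ) ^ 2 ≠ 0 := by nlinarith
  obtain ⟨⟨m₁, hm₁⟩, ⟨m₂, hm₂⟩⟩ := exists_tendsto_integral_mul_radialDensity hx hy
  set D : ℝ := 4 * C + 2 * |b - b'| with hD
  have hD0 : 0 ≤ D := by positivity
  have hbound : ∀ ε : ℝ, 0 < ε → ε < 1 → ∀ r ∈ Set.Ioo (1 - δ) (1 + δ),
      ‖(R r : ℂ) * radialDensity ε r‖ ≤ 2 * D * |r - 1| ^ (β - 1) := by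
    intro ε hε hε1 r hr
    rcases eq_or_ne r 1 with h1 | h1
    · have := hRbound r hr
      rw [h1, sub_self, abs_zero, Real.zero_rpow (by linarith), mul_zero] at this
      rw [h1, abs_nonpos_iff.1 this]
      simp only [Complex.ofReal_zero, zero_mul, norm_zero]
      positivity
    · have hs0 : 0 < |r - 1| := abs_pos.2 (sub_ne_zero.2 h1)
      have hle : |r - 1| ≤ ‖(dEps ε) ^ 2 - (r : ℂ) ^ 2‖ := by
        refine le_trans ?_ (abs_one_sub_sq_le_norm ε r)
        have : 1 - r ^ 2 = -((r - 1) * (r + 1)) := by ring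
        rw [this, abs_neg, abs_mul]
        refine le_mul_of_one_le_right hs0.le ?_
        rw [abs_of_pos (by linarith [hr.1])]
        linarith [hr.1]
      have h2 := norm_radialDensity_le hε hs0 hle
      rw [norm_mul, Complex.norm_real, Real.norm_eq_abs]
      calc |R r| * ‖radialDensity ε r‖
          ≤ (D * |r - 1| ^ (1 + β)) * ((1 + ε) / |r - 1| ^ 2) := by
            gcongr
            exact hRbound r hr
        _ ≤ (D * |r - 1| ^ (1 + β)) * (2 / |r - 1| ^ 2) := by
            gcongr
            linarith
        _ = 2 * D * (|r - 1| ^ (1 + β) / |r - 1| ^ (2 : ℕ)) := by ring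
        _ = 2 * D * |r - 1| ^ (β - 1) := by
            rw [← Real.rpow_natCast, ← Real.rpow_sub hs0]
            congr 2
            push_cast
            ring
  have hdom := (integrableOn_abs_sub_rpow hβ hδ).const_mul (2 * D)
  have hmeasR : ∀ ε : ℝ, 0 < ε → AEStronglyMeasurable (fun r => (R r : ℂ) * radialDensity ε r)
      (volume.restrict (Set.Ioo (1 - δ) (1 + δ))) := fun ε hε =>
    ((Complex.measurable_ofReal.comp hRmeas).mul
      (continuous_radialDensity hε).measurable).aestronglyMeasurable
  have hev : ∀ᶠ ε : ℝ in 𝓝[>] 0, 0 < ε ∧ ε < 1 := Ioo_mem_nhdsGT one_pos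
  have h₃ : Tendsto (fun ε => ∫ r in Set.Ioo (1 - δ) (1 + δ), (R r : ℂ) * radialDensity ε r)
      (𝓝[>] 0) (𝓝 (∫ r in Set.Ioo (1 - δ) (1 + δ), (R r : ℂ) * radialDensity 0 r)) := by
    refine tendsto_integral_filter_of_dominated_convergence _ ?_ ?_ hdom ?_
    · filter_upwards [hev] with ε hε using hmeasR ε hε.1
    · filter_upwards [hev] with ε hε
      filter_upwards [ae_restrict_mem measurableSet_Ioo] with r hr using hbound ε hε.1 hε.2 r hr
    · filter_upwards [ae_restrict_mem measurableSet_Ioo,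
        ae_restrict_of_ae (Measure.ae_ne volume (1 : ℝ))] with r hr hr1
      refine (tendsto_radialDensity ?_).const_mul _
      have : 1 - r ^ 2 = -((r - 1) * (r + 1)) := by ring
      rw [this]
      exact neg_ne_zero.2 (mul_ne_zero (sub_ne_zero.2 hr1) (by linarith [hr.1]))
  refine ⟨_, Tendsto.congr' ?_ (((hm₁.const_mul (a : ℂ)).add (hm₂.const_mul (b' : ℂ))).add h₃)⟩
  filter_upwards [hev] with ε hε
  have hg := continuous_radialDensity hε.1
  have i₁ : IntegrableOn (fun r : ℝ => (a : ℂ) * ((r : ℂ) * radialDensity ε r))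
      (Set.Ioo (1 - δ) (1 + δ)) :=
    (Continuous.integrableOn_Icc (by fun_prop)).mono_set Set.Ioo_subset_Icc_self
  have i₂ : IntegrableOn (fun r : ℝ => (b' : ℂ) * (((r * (r ^ 2 - 1) : ℝ) : ℂ) *
      radialDensity ε r)) (Set.Ioo (1 - δ) (1 + δ)) :=
    (Continuous.integrableOn_Icc (by fun_prop)).mono_set Set.Ioo_subset_Icc_self
  have i₃ : IntegrableOn (fun r => (R r : ℂ) * radialDensity ε r) (Set.Ioo (1 - δ) (1 + δ)) := by
    refine Integrable.mono' hdom (hmeasR ε hε.1) ?_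
    filter_upwards [ae_restrict_mem measurableSet_Ioo] with r hr using hbound ε hε.1 hε.2 r hr
  rw [intervalIntegral.integral_of_le (by linarith), intervalIntegral.integral_of_le (by linarith),
    integral_Ioc_eq_integral_Ioo, integral_Ioc_eq_integral_Ioo, ← integral_const_mul,
    ← integral_const_mul, ← integral_add i₁ i₂, ← integral_add (by exact i₁.add i₂) i₃]
  congr 1
  ext r
  rw [hR]
  push_cast
  ring

/-! ### Polar coordinates -/

/-- Integration in polar coordinates. -/
lemma integral_eq_integral_Ioi_integral_sphere {E F : Type*} [NormedAddCommGroup E]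
    [NormedSpace ℝ E] [FiniteDimensional ℝ E] [Nontrivial E] [MeasurableSpace E] [BorelSpace E]
    [NormedAddCommGroup F] [NormedSpace ℝ F] (μ : Measure E) [μ.IsAddHaarMeasure] {f : E → F}
    (hf : Integrable f μ) :
    ∫ x, f x ∂μ = ∫ r in Set.Ioi (0 : ℝ), r ^ (Module.finrank ℝ E - 1) •
      ∫ θ, f (r • (θ : E)) ∂μ.toSphere := by
  set Φ := homeomorphUnitSphereProd E with hΦ
  have hmp := μ.measurePreserving_homeomorphUnitSphereProd
  have hsymm : ∀ z : Metric.sphere (0 : E) 1 × Set.Ioi (0 : ℝ),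
      ((Φ.symm z : ({0}ᶜ : Set E)) : E) = (z.2 : ℝ) • (z.1 : E) := fun z => by
    simp [hΦ]
  have hcomp : ∀ x : ({0}ᶜ : Set E),
      f x = (fun z => f ((z.2 : ℝ) • (z.1 : E))) (Φ x) := fun x => by
    simp only
    rw [← hsymm, Homeomorph.symm_apply_apply]
  have hint : Integrable (fun z : Metric.sphere (0 : E) 1 × Set.Ioi (0 : ℝ) =>
      f ((z.2 : ℝ) • (z.1 : E)))
      (μ.toSphere.prod (.volumeIoiPow (Module.finrank ℝ E - 1))) := by
    rw [← hmp.integrable_comp_emb Φ.measurableEmbedding]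
    have h1 : IntegrableOn f ({0}ᶜ : Set E) μ := hf.integrableOn
    rw [integrableOn_iff_comap_subtypeVal (measurableSet_singleton _).compl] at h1
    exact h1.congr (Eventually.of_forall hcomp)
  calc ∫ x, f x ∂μ = ∫ x : ({0}ᶜ : Set E), f x ∂(μ.comap (↑)) := by
        rw [integral_subtype_comap (measurableSet_singleton _).compl f,
          restrict_compl_singleton]
    _ = ∫ z, f ((z.2 : ℝ) • (z.1 : E))
          ∂(μ.toSphere.prod (.volumeIoiPow (Module.finrank ℝ E - 1))) := by
        rw [← hmp.integral_comp Φ.measurableEmbedding]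
        exact integral_congr_ae (Eventually.of_forall hcomp)
    _ = ∫ r : Set.Ioi (0 : ℝ), ∫ θ, f ((r : ℝ) • (θ : E)) ∂μ.toSphere
          ∂(.volumeIoiPow (Module.finrank ℝ E - 1)) := integral_prod_symm _ hint
    _ = _ := by
        simp only [Measure.volumeIoiPow, ENNReal.ofReal]
        rw [integral_withDensity_eq_integral_smul,
          integral_subtype_comap measurableSet_Ioi fun r : ℝ =>
            Real.toNNReal (r ^ (Module.finrank ℝ E - 1)) • ∫ θ, f (r • (θ : E)) ∂μ.toSphere,
          setIntegral_congr_fun measurableSet_Ioi fun r hr => ?_]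
        · rw [NNReal.smul_def, Real.coe_toNNReal _ (pow_nonneg (Set.mem_Ioi.1 hr).le _)]
        · exact (measurable_subtype_coe.pow_const _).real_toNNReal

/-- The spherical shell of points whose distance to the unit sphere is less than `δ`. -/
def shell (δ : ℝ) : Set K3 := {x | ‖x‖ ∈ Set.Ioo (1 - δ) (1 + δ)}

lemma measurableSet_shell (δ : ℝ) : MeasurableSet (shell δ) :=
  measurable_norm measurableSet_Ioo

lemma setIntegral_inter_shell {S : Set K3} (hS : MeasurableSet S) {g : ℝ → ℂ}
    (hg : Continuous g) {δ : ℝ} (hδ : δ ≤ 1) :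
    ∫ x in S ∩ shell δ, g ‖x‖ = ∫ r in Set.Ioo (1 - δ) (1 + δ),
      ((r ^ 2 * ∫ θ, S.indicator (1 : K3 → ℝ) (r • (θ : K3)) ∂sphereMeasure : ℝ) : ℂ) * g r := by
  have hmeas : MeasurableSet (S ∩ shell δ) := hS.inter (measurableSet_shell δ)
  have hint : IntegrableOn (fun x : K3 => g ‖x‖) (S ∩ shell δ) := by
    refine ((hg.comp continuous_norm).continuousOn.integrableOn_compact
      (isCompact_closedBall (0 : K3) (1 + δ))).mono_set fun x hx => ?_
    rw [mem_closedBall_zero_iff]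
    exact hx.2.2.le
  rw [← integral_indicator hmeas,
    integral_eq_integral_Ioi_integral_sphere volume (hint.integrable_indicator hmeas)]
  have hsub : Set.Ioo (1 - δ) (1 + δ) ⊆ Set.Ioi (0 : ℝ) := fun r hr => by
    rw [Set.mem_Ioi]
    linarith [hr.1]
  rw [setIntegral_eq_of_subset_of_forall_sdiff_eq_zero measurableSet_Ioi hsub]
  · refine setIntegral_congr_fun measurableSet_Ioo fun r hr => ?_
    have hr0 : 0 < r := hsub hr
    have hshell : ∀ θ : Metric.sphere (0 : K3) 1, r • (θ : K3) ∈ shell δ := fun θ => by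
      simpa [shell, norm_smul, abs_of_pos hr0] using hr
    have hptw : ∀ θ : Metric.sphere (0 : K3) 1,
        (S ∩ shell δ).indicator (fun x : K3 => g ‖x‖) (r • (θ : K3)) =
          ((S.indicator (1 : K3 → ℝ) (r • (θ : K3)) : ℝ) : ℂ) * g r := by
      intro θ
      by_cases h : r • (θ : K3) ∈ S
      · rw [Set.indicator_of_mem (Set.mem_inter h (hshell θ)), Set.indicator_of_mem h]
        simp [norm_smul, abs_of_pos hr0]
      · rw [Set.indicator_of_notMem (fun h' => h h'.1), Set.indicator_of_notMem h]
        simp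
    simp only [hptw]
    rw [integral_mul_const, integral_complex_ofReal]
    simp
    ring
  · intro r hr
    have hr0 : 0 < r := hr.1
    have : ∀ θ : Metric.sphere (0 : K3) 1, r • (θ : K3) ∉ shell δ := fun θ => by
      have := hr.2
      simpa [shell, norm_smul, abs_of_pos hr0] using this
    have hptw : ∀ θ : Metric.sphere (0 : K3) 1,
        (S ∩ shell δ).indicator (fun x : K3 => g ‖x‖) (r • (θ : K3)) = 0 := fun θ =>
      Set.indicator_of_notMem (fun h => this θ h.2) _
    simp [hptw]

lemma measurable_slice {S : Set K3} (hS : MeasurableSet S) :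
    Measurable fun r : ℝ => ∫ θ, S.indicator (1 : K3 → ℝ) (r • (θ : K3)) ∂sphereMeasure := by
  have : Measurable fun z : ℝ × Metric.sphere (0 : K3) 1 =>
      S.indicator (1 : K3 → ℝ) (z.1 • (z.2 : K3)) :=
    (measurable_one.indicator hS).comp
      (measurable_fst.smul (measurable_subtype_coe.comp measurable_snd))
  exact (this.stronglyMeasurable.integral_prod_right (ν := sphereMeasure)).measurable

/-! ### Integrability away from the sphere -/

lemma norm_volDensity_le {ε η : ℝ} (hε : 0 < ε) (hη : 0 < η) {x : K3}
    (h : η ≤ ‖(dEps ε) ^ 2 - ((‖x‖ : ℝ) : ℂ) ^ 2‖) :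
    ‖volDensity ε x‖ ≤ (1 + ε) * (1 + 2 / η) ^ 2 * (1 + ‖x‖ ^ 2) ^ (-(4 : ℝ) / 2) := by
  set z := ‖(dEps ε) ^ 2 - ((‖x‖ : ℝ) : ℂ) ^ 2‖ with hz
  have hz0 : 0 < z := hη.trans_le h
  have h1 : 1 + ‖x‖ ^ 2 ≤ z * (1 + 2 / η) := by
    have h2 := (neg_abs_le (1 - ‖x‖ ^ 2)).trans' (neg_le_neg (abs_one_sub_sq_le_norm ε ‖x‖))
    have h3 : 2 ≤ z * (2 / η) := by
      rw [mul_div_assoc', le_div_iff₀ hη]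
      linarith
    rw [← hz] at h2
    linarith
  have h4 : (1 + ‖x‖ ^ 2) ^ (-(4 : ℝ) / 2) = ((1 + ‖x‖ ^ 2) ^ 2)⁻¹ := by
    rw [show -(4 : ℝ) / 2 = -((2 : ℕ) : ℝ) by norm_num, Real.rpow_neg (by positivity),
      Real.rpow_natCast]
  rw [volDensity_eq, h4]
  refine (norm_radialDensity_le hε hz0 le_rfl).trans ?_
  rw [mul_assoc, div_eq_mul_inv]
  gcongr
  rw [← div_eq_mul_inv, le_div_iff₀ (by positivity), inv_mul_le_iff₀ (by positivity), ← mul_pow]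
  gcongr

lemma integrable_one_add_norm_sq_rpow :
    Integrable fun x : K3 => (1 + ‖x‖ ^ 2) ^ (-(4 : ℝ) / 2) :=
  integrable_rpow_neg_one_add_norm_sq (by rw [finrank_euclideanSpace_fin]; norm_num)

lemma continuous_volDensity {ε : ℝ} (hε : 0 < ε) : Continuous (volDensity ε) :=
  (continuous_radialDensity hε).comp continuous_norm

lemma integrable_volDensity {ε : ℝ} (hε : 0 < ε) : Integrable (volDensity ε) :=
  (integrable_one_add_norm_sq_rpow.const_mul _).mono'
    (continuous_volDensity hε).aestronglyMeasurable
    (Eventually.of_forall fun _ => norm_volDensity_le hε (mul_pos two_pos hε) (two_mul_le_norm ε _))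

lemma le_abs_one_sub_sq_of_notMem_shell {δ : ℝ} {x : K3} (hx : x ∉ shell δ) :
    δ ≤ |1 - ‖x‖ ^ 2| := by
  have h1 : δ ≤ |1 - ‖x‖| := by
    by_contra! h
    rw [abs_lt] at h
    exact hx ⟨by linarith [h.2], by linarith [h.1]⟩
  have h2 : 1 - ‖x‖ ^ 2 = (1 - ‖x‖) * (1 + ‖x‖) := by ring
  rw [h2, abs_mul, abs_of_nonneg (by positivity : 0 ≤ 1 + ‖x‖)]
  exact h1.trans (le_mul_of_one_le_right (abs_nonneg _) (by linarith [norm_nonneg x]))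

/-- Away from the sphere the densities converge dominatedly. -/
lemma exists_tendsto_setIntegral_diff_shell {U : Set K3} (hU : NullMeasurableSet U) {δ : ℝ}
    (hδ : 0 < δ) :
    ∃ m : ℂ, Tendsto (fun ε => ∫ x in U \ shell δ, volDensity ε x) (𝓝[>] 0) (𝓝 m) := by
  have hmem : ∀ᵐ x ∂(volume.restrict (U \ shell δ)), x ∈ U \ shell δ :=
    ae_restrict_mem₀ (hU.diff (measurableSet_shell δ).nullMeasurableSet)
  have hev : ∀ᶠ ε : ℝ in 𝓝[>] 0, 0 < ε ∧ ε < 1 := Ioo_mem_nhdsGT one_pos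
  refine ⟨∫ x in U \ shell δ, volDensity 0 x, tendsto_integral_filter_of_dominated_convergence
    (fun x => 2 * (1 + 2 / δ) ^ 2 * (1 + ‖x‖ ^ 2) ^ (-(4 : ℝ) / 2)) ?_ ?_
    (integrable_one_add_norm_sq_rpow.const_mul _).integrableOn ?_⟩
  · filter_upwards [hev] with ε hε using (continuous_volDensity hε.1).aestronglyMeasurable
  · filter_upwards [hev] with ε hε
    filter_upwards [hmem] with x hx
    refine (norm_volDensity_le hε.1 hδ
      ((le_abs_one_sub_sq_of_notMem_shell hx.2).trans (abs_one_sub_sq_le_norm ε _))).trans ?_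
    gcongr
    linarith [hε.2]
  · filter_upwards [hmem] with x hx
    refine tendsto_radialDensity (r := ‖x‖) (abs_pos.1 ?_)
    exact hδ.trans_le (le_abs_one_sub_sq_of_notMem_shell hx.2)

/-! ### Convergence of the volume -/

theorem theorem3p2 (α : ℝ≥0) (hα : 0 < α) (hα1 : α ≤ 1) (U : Set K3)
    (hU : NullMeasurableSet U volume) (hT : IsC1HolderTransversal α U) :
    ∃ m : ℂ, HasMu U m := by
  obtain ⟨hexp, hfr⟩ := expandsAtOne_slice hα hα1 hT
  obtain ⟨δ₀, hδ₀, hlim⟩ := hexp.exists_tendsto (NNReal.coe_pos.2 hα) hα1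
    (measurable_slice isOpen_interior.measurableSet)
  obtain ⟨δ₁, hδ₁, hball⟩ := Metric.eventually_nhds_iff_ball.1 hfr
  set δ := min (min δ₀ δ₁) 1 with hδ
  have hδ0 : 0 < δ := by positivity
  have hδle : δ ≤ δ₀ := (min_le_left _ _).trans (min_le_left _ _)
  have hδle₁ : δ ≤ δ₁ := (min_le_left _ _).trans (min_le_right _ _)
  have hδ1 : δ ≤ 1 := min_le_right _ _
  obtain ⟨m₁, hm₁⟩ := hlim δ hδ0 hδle
  obtain ⟨m₂, hm₂⟩ := exists_tendsto_setIntegral_diff_shell hU hδ0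
  -- `U` may be replaced by its interior in the shell, where its frontier is a null set
  have hnull : volume (frontier U ∩ shell δ) = 0 := by
    have h := setIntegral_inter_shell (isClosed_frontier (s := U)).measurableSet
      (continuous_const (y := (1 : ℂ))) hδ1
    have h0 : ∫ r in Set.Ioo (1 - δ) (1 + δ), ((r ^ 2 * ∫ θ, (frontier U).indicator (1 : K3 → ℝ)
        (r • (θ : K3)) ∂sphereMeasure : ℝ) : ℂ) * (1 : ℂ) = 0 := by
      refine setIntegral_eq_zero_of_forall_eq_zero fun r hr => ?_
      rw [hball r (by
        rw [Metric.mem_ball, Real.dist_eq, abs_lt]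
        exact ⟨by linarith [hr.1], by linarith [hr.2]⟩)]
      simp
    rw [h0, setIntegral_const] at h
    have hfin : volume (frontier U ∩ shell δ) ≠ ⊤ := by
      refine ((measure_mono fun x hx => ?_).trans_lt
        (measure_closedBall_lt_top (x := (0 : K3)) (r := 1 + δ))).ne
      rw [mem_closedBall_zero_iff]
      exact hx.2.2.le
    have h2 : volume.real (frontier U ∩ shell δ) = 0 := by simpa using h
    exact (measureReal_eq_zero_iff hfin).1 h2
  have hae : (U ∩ shell δ : Set K3) =ᵐ[volume] (interior U ∩ shell δ : Set K3) := by
    filter_upwards [measure_eq_zero_iff_ae_notMem.1 hnull] with x hx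
    refine propext ⟨fun h => ⟨?_, h.2⟩, fun h => ⟨interior_subset h.1, h.2⟩⟩
    by_contra hint
    exact hx ⟨⟨subset_closure h.1, hint⟩, h.2⟩
  refine ⟨m₁ + m₂, fun ε hε => (integrable_volDensity hε).integrableOn,
    (hm₁.add hm₂).congr' ?_⟩
  filter_upwards [self_mem_nhdsWithin] with ε hε
  rw [← integral_inter_add_sdiff (s := U) (measurableSet_shell δ)
      (integrable_volDensity hε).integrableOn,
    setIntegral_congr_set hae,
    ← setIntegral_inter_shell isOpen_interior.measurableSet (continuous_radialDensity hε) hδ1]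
  rfl
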